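/- Let $S_m$ be the group of permutations of $\{1,\dots,m\}$, let $S_m\subset S_{m+1}$ by fixing $m+1$, and put $S_\infty=\bigcup_m S_m$. For $w\in S_m$ let $\mathfrak S_w\in\mathbb Z[x_1,x_2,\dots]$ be the Schubert polynomial: $\mathfrak S_{w_0}=x_1^{m-1}x_2^{m-2}\cdots x_{m-1}$ for the longest element $w_0$ of $S_m$, and $\partial_i\mathfrak S_w=\mathfrak S_{ws_i}$ whenever $w(i)>w(i+1)$, $1\le i<m$, where $\partial_i f=(f-s_if)/(x_i-x_{i+1})$ and $s_i$ exchanges $i$ and $i+1$ (respectively $x_i$ and $x_{i+1}$). Let $n_1,n_2$ be positive integers and let $k\le n_2$. Let $\tau\in S_{n_1}$ be $k$-Grassmannian, that is, $\tau(1)<\cdots<\tau(k)$ and $\tau(k+1)<\cdots<\tau(n_1)$, and suppose that the partition $\lambda=(\tau(k)-k,\dots,\tau(2)-2,\tau(1)-1)$ (zero parts dropped) has exactly two rows, $\lambda=(m_1,m_2)$ with $m_1\ge m_2\ge 1$. Let $s_\lambda(x_1,\dots,x_k)$ be the Schur polynomial of $\lambda$, the generating function of the semistandard Young tableaux of shape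 $\lambda$ with entries in $\{1,\dots,k\}$. Let $w\in S_{n_2}$ and suppose that $n_2-k<m_2$. Then there are unique integers $c_{w\tau}^v$ ($v\in S_\infty$), all but finitely many of them zero, with $$\mathfrak S_w\, s_\lambda(x_1,\dots,x_k)=\sum_{v\in S_\infty}c_{w\tau}^v\,\mathfrak S_v ,$$ and for every $v\in S_\infty$ $$c_{w\tau}^v\le 2^{\,n_2-k}\,(n_2-k)!\,.$$ If in addition $w(k+1)>w(k+2)>\cdots>w(n_2)$, then $c_{w\tau}^v\le 2^{\,n_2-k}$ for every $v\in S_\infty$. -/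

import Mathlib

open Equiv MvPolynomial
open scoped Nat

/-!
Conventions.  Positions, values and variables are indexed from `0`: the permutation written
`w(1), w(2), …` in one-line notation is `w 0 + 1, w 1 + 1, …`, and the variable `x_i` is
`X (i - 1)`.  Polynomials live in `ℤ[x_1, x_2, …] = MvPolynomial ℕ ℤ`.
-/

/-- `S_n`, as the group of permutations of `ℕ` that fix every `i ≥ n`; thus `S_n ⊆ S_{n+1}`. -/
def symN (n : ℕ) : Subgroup (Perm ℕ) where
  carrier := {w | ∀ i, n ≤ i → w i = i}
  one_mem' := fun _ _ => rfl
  mul_mem' := fun {a b} ha hb i hi => by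
    rw [Perm.mul_apply, hb i hi, ha i hi]
  inv_mem' := fun {a} ha i hi => by
    rw [Perm.inv_eq_iff_eq, ha i hi]

/-- `S_∞`, the union of all the groups `S_n`. -/
def symInf : Subgroup (Perm ℕ) where
  carrier := {w | ∃ n, w ∈ symN n}
  one_mem' := ⟨0, (symN 0).one_mem⟩
  mul_mem' := fun {_ _} ⟨n, hn⟩ ⟨m, hm⟩ => ⟨max n m, (symN (max n m)).mul_mem
    (fun i hi => hn i (le_trans (le_max_left n m) hi))
    (fun i hi => hm i (le_trans (le_max_right n m) hi))⟩
  inv_mem' := fun {_} ⟨n, hn⟩ => ⟨n, (symN n).inv_mem hn⟩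

/-- `f - s_i f` is divisible by `x_i - x_{i+1}`. -/
theorem X_sub_X_dvd (i : ℕ) (f : MvPolynomial ℕ ℤ) :
    (X i - X (i + 1) : MvPolynomial ℕ ℤ) ∣ f - rename (swap i (i + 1)) f := by
  induction f using MvPolynomial.induction_on with
  | C a => simp
  | add p q hp hq =>
    rw [map_add, add_sub_add_comm]
    exact dvd_add hp hq
  | mul_X p m hp =>
    have h : (X i - X (i + 1) : MvPolynomial ℕ ℤ) ∣ X m - X (swap i (i + 1) m) := by
      rcases eq_or_ne m i with rfl | h1
      · rw [swap_apply_left]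
      · rcases eq_or_ne m (i + 1) with rfl | h2
        · rw [swap_apply_right]
          exact ⟨-1, by ring⟩
        · rw [swap_apply_of_ne_of_ne h1 h2, sub_self]
          exact dvd_zero _
    have e : p * X m - rename (swap i (i + 1)) (p * X m)
        = (p - rename (swap i (i + 1)) p) * X m
          + rename (swap i (i + 1)) p * (X m - X (swap i (i + 1) m)) := by
      rw [map_mul, rename_X]
      ring
    rw [e]
    exact dvd_add (hp.mul_right _) (h.mul_left _)

/-- The divided difference operator `∂_i f = (f - s_i f) / (x_i - x_{i+1})`. -/
noncomputable def divDiff (i : ℕ) (f : MvPolynomial ℕ ℤ) : MvPolynomial ℕ ℤ :=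
  (X_sub_X_dvd i f).choose

theorem divDiff_spec (i : ℕ) (f : MvPolynomial ℕ ℤ) :
    (X i - X (i + 1)) * divDiff i f = f - rename (swap i (i + 1)) f :=
  (X_sub_X_dvd i f).choose_spec.symm

/-- Exchanging the values at an ascent lowers `∑ i * w(i)`. -/
theorem sum_mul_swap_lt (n i : ℕ) (w : Perm ℕ) (hi : i + 1 < n) (hw : w i < w (i + 1)) :
    ∑ j ∈ Finset.range n, j * (w * swap i (i + 1)) j < ∑ j ∈ Finset.range n, j * w j := by
  have h1 : i ∈ Finset.range n := Finset.mem_range.2 (by omega)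
  have h2 : i + 1 ∈ (Finset.range n).erase i :=
    Finset.mem_erase.2 ⟨by omega, Finset.mem_range.2 hi⟩
  rw [← Finset.add_sum_erase _ _ h1, ← Finset.add_sum_erase _ _ h2,
    ← Finset.add_sum_erase (Finset.range n) (fun j => j * w j) h1,
    ← Finset.add_sum_erase _ (fun j => j * w j) h2]
  have h3 : ∑ j ∈ ((Finset.range n).erase i).erase (i + 1), j * (w * swap i (i + 1)) j
      = ∑ j ∈ ((Finset.range n).erase i).erase (i + 1), j * w j := by
    refine Finset.sum_congr rfl fun j hj => ?_
    simp only [Finset.mem_erase] at hj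
    rw [Perm.mul_apply, swap_apply_of_ne_of_ne hj.2.1 hj.1]
  rw [h3]
  simp only [Perm.mul_apply, swap_apply_left, swap_apply_right]
  nlinarith

/-- The ascents of `w` among the positions `1, …, n`. -/
def ascents (n : ℕ) (w : Perm ℕ) : Set ℕ := {i | i + 1 < n ∧ w i < w (i + 1)}

/-- The first ascent of `w` (if there is any). -/
noncomputable def firstAscent (n : ℕ) (w : Perm ℕ) : ℕ := sInf (ascents n w)

open Classical in
/-- The Schubert polynomial of `w ∈ S_n`, computed inside `S_n`.  For the longest element `w_0`
(the only one without an ascent) it is `x_1^{n-1} x_2^{n-2} ⋯ x_{n-1}`.  Otherwise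
`𝔖_w = ∂_i 𝔖_{w s_i}` where `i` is the first ascent of `w`, hence a descent of `w s_i`. -/
noncomputable def schubertIn (n : ℕ) (w : Perm ℕ) : MvPolynomial ℕ ℤ :=
  if h : (ascents n w).Nonempty then
    divDiff (firstAscent n w) (schubertIn n (w * swap (firstAscent n w) (firstAscent n w + 1)))
  else ∏ i ∈ Finset.range n, X i ^ (n - 1 - i)
termination_by ∑ j ∈ Finset.range n, j * w j
decreasing_by exact sum_mul_swap_lt n _ w (Nat.sInf_mem h).1 (Nat.sInf_mem h).2

open Classical in
/-- The Schubert polynomial `𝔖_w` of `w ∈ S_∞`, computed in the smallest `S_n` containing `w`. -/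
noncomputable def schubert (w : symInf) : MvPolynomial ℕ ℤ :=
  schubertIn (Nat.find w.2) w.1

/-- The semistandard Young tableaux of shape `μ` with entries in a `k`-element alphabet
(here `0, …, k - 1`). -/
abbrev BoundedSSYT (μ : YoungDiagram) (k : ℕ) : Type :=
  {T : SemistandardYoungTableau μ // ∀ c ∈ μ.cells, T c.1 c.2 < k}

theorem finite_boundedSSYT (μ : YoungDiagram) (k : ℕ) : Finite (BoundedSSYT μ k) := by
  let F : BoundedSSYT μ k → (μ.cells → Fin k) := fun T c => ⟨T.1 c.1.1 c.1.2, T.2 c.1 c.2⟩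
  refine Finite.of_injective F fun T T' h => Subtype.ext ?_
  refine SemistandardYoungTableau.ext fun i j => ?_
  by_cases hc : (i, j) ∈ μ
  · have := congrFun h ⟨(i, j), hc⟩
    exact congrArg Fin.val this
  · rw [T.1.zeros hc, T'.1.zeros hc]

noncomputable instance (μ : YoungDiagram) (k : ℕ) : Fintype (BoundedSSYT μ k) :=
  @Fintype.ofFinite _ (finite_boundedSSYT μ k)

/-- The Schur polynomial `s_μ(x_1, …, x_k)`. -/
noncomputable def schur (μ : YoungDiagram) (k : ℕ) : MvPolynomial ℕ ℤ :=
  ∑ T : BoundedSSYT μ k, ∏ c ∈ μ.cells, X (T.1 c.1 c.2)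

/-- `w ∈ S_n` is `k`-Grassmannian: `w(1) < ⋯ < w(k)` and `w(k+1) < ⋯ < w(n)`. -/
def IsGrassmannian (k n : ℕ) (w : Perm ℕ) : Prop :=
  (∀ i j, i < j → j < k → w i < w j) ∧ (∀ i j, k ≤ i → i < j → j < n → w i < w j)

/-- `μ` is the Young diagram of the `k`-Grassmannian permutation `w`, that is, the partition
`(w(k) - k, …, w(2) - 2, w(1) - 1)` with its zero parts dropped. -/
def IsShapeOf (μ : YoungDiagram) (k : ℕ) (w : Perm ℕ) : Prop :=
  ∀ i, μ.rowLen i = if i < k then w (k - 1 - i) - (k - 1 - i) else 0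

/-- `f = ∑_{v ∈ S_∞} c_v 𝔖_v`. -/
def IsSchubertExpansion (f : MvPolynomial ℕ ℤ) (c : symInf →₀ ℤ) : Prop :=
  f = c.sum fun v a => C a * schubert v

/-! By the two-row Jacobi–Trudi formula (`rowPairSum_eq`), s_λ = h_{m₁} h_{m₂} - h_{m₁+1} h_{m₂-1},
with complete homogeneous polynomials in the first k variables. Both products, multiplied by 𝔖_w,
have nonnegative Schubert coefficients, so c_{wτ}^v is at most the coefficient of 𝔖_v in 𝔖_w h_{m₁}
h_{m₂}.

Pieri's rule (`sch_mul_completeH`) writes 𝔖_w h_m as a sum over Pieri chains of length m: saturated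
chains in the k-Bruhat order whose larger exchanged values increase. That coefficient therefore
counts pairs of consecutive Pieri chains from w to v of lengths m₁ and m₂. Such a pair is determined
by the set of positions in {k, …, n₂-1} (counted from 0) used by the first chain. The positions ≥ n₂
that it uses form an initial segment of {n₂, n₂+1, …}, hence are fixed by its length
(`PieriChain.toFinset_snd_eq`). The full set of positions ≥ k determines the first chain once the
endpoint v of the pair is given (`pieriChain_eq`), and the second chain is then determined by its
two ends. So there are at most 2^(n₂-k) pairs (`card_chainPairs_le`); the bound with the factorial
follows because (n₂-k)! ≥ 1.

Pieri's rule is derived from Monk's rule for multiplication by a variable (`X_mul_sch`) by induction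
on k and m, through h_{m+1}(k+1) = h_{m+1}(k) + x_k h_m(k+1), where h_m(k) uses the variables of
index below k. The chains are organised by operators on the free module on permutations, and the
quadratic relation `bruhatOp_relation` makes the terms cancel. Monk's rule holds because both sides
have the same divided differences and no constant term. Uniqueness of the expansion comes from
functionals dual to the Schubert polynomials (`exists_coeff_functional`). -/

/-! ### Divided differences -/

theorem X_sub_X_succ_ne_zero (i : ℕ) : (X i - X (i + 1) : MvPolynomial ℕ ℤ) ≠ 0 := by
  rw [sub_ne_zero]
  intro h
  have := X_injective h
  omega

theorem divDiff_eq_of_mul_eq {i : ℕ} {f g : MvPolynomial ℕ ℤ}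
    (h : (X i - X (i + 1)) * g = f - rename (swap i (i + 1)) f) : divDiff i f = g :=
  mul_left_cancel₀ (X_sub_X_succ_ne_zero i) ((divDiff_spec i f).trans h.symm)

theorem divDiff_add (i : ℕ) (f g : MvPolynomial ℕ ℤ) :
    divDiff i (f + g) = divDiff i f + divDiff i g := by
  apply divDiff_eq_of_mul_eq
  rw [mul_add, divDiff_spec, divDiff_spec, map_add]
  ring

/-- The divided difference operator as an additive map. -/
noncomputable def divDiffHom (i : ℕ) : MvPolynomial ℕ ℤ →+ MvPolynomial ℕ ℤ :=
  AddMonoidHom.mk' (divDiff i) (divDiff_add i)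

@[simp] theorem divDiffHom_apply (i : ℕ) (f : MvPolynomial ℕ ℤ) : divDiffHom i f = divDiff i f :=
  rfl

theorem divDiff_zero (i : ℕ) : divDiff i 0 = 0 := map_zero (divDiffHom i)

theorem divDiff_sub (i : ℕ) (f g : MvPolynomial ℕ ℤ) :
    divDiff i (f - g) = divDiff i f - divDiff i g := map_sub (divDiffHom i) f g

theorem divDiff_sum {ι : Type*} (s : Finset ι) (i : ℕ) (f : ι → MvPolynomial ℕ ℤ) :
    divDiff i (∑ j ∈ s, f j) = ∑ j ∈ s, divDiff i (f j) := map_sum (divDiffHom i) f s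

theorem divDiff_mul (i : ℕ) (f g : MvPolynomial ℕ ℤ) :
    divDiff i (f * g) = divDiff i f * g + rename (swap i (i + 1)) f * divDiff i g := by
  apply divDiff_eq_of_mul_eq
  have hf := divDiff_spec i f
  have hg := divDiff_spec i g
  rw [map_mul]
  linear_combination g * hf + rename (swap i (i + 1)) f * hg

theorem divDiff_eq_zero_iff {i : ℕ} {f : MvPolynomial ℕ ℤ} :
    divDiff i f = 0 ↔ rename (swap i (i + 1)) f = f := by
  constructor
  · intro h
    have := divDiff_spec i f
    rw [h, mul_zero] at this
    exact (sub_eq_zero.1 this.symm).symm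
  · intro h
    apply divDiff_eq_of_mul_eq
    rw [h]
    simp

theorem divDiff_mul_of_invariant {i : ℕ} {f : MvPolynomial ℕ ℤ} (g : MvPolynomial ℕ ℤ)
    (hf : rename (swap i (i + 1)) f = f) : divDiff i (f * g) = f * divDiff i g := by
  rw [divDiff_mul, divDiff_eq_zero_iff.2 hf, hf, zero_mul, zero_add]

theorem rename_swap_swap (i j : ℕ) (f : MvPolynomial ℕ ℤ) :
    rename (swap i j) (rename (swap i j) f) = f := by
  rw [rename_rename, ← Perm.coe_mul, swap_mul_self, Perm.coe_one, rename_id_apply]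

theorem rename_divDiff (i : ℕ) (f : MvPolynomial ℕ ℤ) :
    rename (swap i (i + 1)) (divDiff i f) = divDiff i f := by
  have h := congrArg (rename (swap i (i + 1))) (divDiff_spec i f)
  rw [map_mul, map_sub, map_sub, rename_X, rename_X, rename_swap_swap, swap_apply_left,
    swap_apply_right] at h
  refine mul_left_cancel₀ (X_sub_X_succ_ne_zero i) ?_
  linear_combination -h - divDiff_spec i f

theorem divDiff_divDiff_self (i : ℕ) (f : MvPolynomial ℕ ℤ) : divDiff i (divDiff i f) = 0 :=
  divDiff_eq_zero_iff.2 (rename_divDiff i f)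

theorem divDiff_C (i : ℕ) (a : ℤ) : divDiff i (C a) = 0 :=
  divDiff_eq_zero_iff.2 (rename_C _ _)

theorem divDiff_X_self (i : ℕ) : divDiff i (X i) = 1 := by
  apply divDiff_eq_of_mul_eq
  rw [rename_X, swap_apply_left, mul_one]

theorem divDiff_X_succ (i : ℕ) : divDiff i (X (i + 1)) = -1 := by
  apply divDiff_eq_of_mul_eq
  rw [rename_X, swap_apply_right]
  ring

theorem divDiff_X_of_ne {i j : ℕ} (h : j ≠ i) (h' : j ≠ i + 1) : divDiff i (X j) = 0 :=
  divDiff_eq_zero_iff.2 (by rw [rename_X, swap_apply_of_ne_of_ne h h'])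

theorem swap_mul_swap_comm {a b c d : ℕ} (h1 : a ≠ c) (h2 : a ≠ d) (h3 : b ≠ c) (h4 : b ≠ d) :
    swap a b * swap c d = swap c d * swap a b := by
  rw [swap_mul_eq_mul_swap, swap_inv, swap_apply_of_ne_of_ne h1 h2, swap_apply_of_ne_of_ne h3 h4]

theorem divDiff_comm {i j : ℕ} (h : i + 1 < j) (f : MvPolynomial ℕ ℤ) :
    divDiff i (divDiff j f) = divDiff j (divDiff i f) := by
  have key : (X i - X (i + 1)) * ((X j - X (j + 1)) * divDiff i (divDiff j f))
      = (X i - X (i + 1)) * ((X j - X (j + 1)) * divDiff j (divDiff i f)) := by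
    have h1 := divDiff_spec i (divDiff j f)
    have h2 := divDiff_spec j (divDiff i f)
    have h3 := divDiff_spec j f
    have h4 := divDiff_spec i f
    have h5 := congrArg (rename (swap i (i + 1))) h3
    have h6 := congrArg (rename (swap j (j + 1))) h4
    rw [map_mul, map_sub, map_sub, rename_X, rename_X,
      swap_apply_of_ne_of_ne (by omega) (by omega),
      swap_apply_of_ne_of_ne (by omega) (by omega)] at h5 h6
    have h7 : rename (swap i (i + 1)) (rename (swap j (j + 1)) f)
        = rename (swap j (j + 1)) (rename (swap i (i + 1)) f) := by
      rw [rename_rename, rename_rename, ← Perm.coe_mul, ← Perm.coe_mul]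
      rw [swap_mul_swap_comm (by omega) (by omega) (by omega) (by omega)]
    linear_combination (X j - X (j + 1)) * h1 - (X i - X (i + 1)) * h2 + h3 - h4 - h5 + h6 + h7
  exact mul_left_cancel₀ (X_sub_X_succ_ne_zero j)
    (mul_left_cancel₀ (X_sub_X_succ_ne_zero i) key)

/-- Multiplied by the Vandermonde product in x_i, x_{i+1}, x_{i+2}, either side becomes the
alternating sum of `f` over the six permutations of these variables. -/
theorem divDiff_braid (i : ℕ) (f : MvPolynomial ℕ ℤ) :
    divDiff i (divDiff (i + 1) (divDiff i f))
      = divDiff (i + 1) (divDiff i (divDiff (i + 1) f)) := by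
  have e0 : ∀ (g : MvPolynomial ℕ ℤ), rename (swap i (i + 1)) (rename (swap (i + 1) (i + 2))
      (rename (swap i (i + 1)) g)) = rename (swap (i + 1) (i + 2)) (rename (swap i (i + 1))
      (rename (swap (i + 1) (i + 2)) g)) := by
    intro g
    simp only [rename_rename, ← Perm.coe_mul]
    congr 2
    rw [← mul_assoc, ← mul_assoc, swap_mul_swap_mul_swap (by omega) (by omega),
      swap_comm i (i + 1), swap_comm (i + 1) (i + 2),
      swap_mul_swap_mul_swap (by omega) (by omega), swap_comm]
  have sa : ∀ g : MvPolynomial ℕ ℤ, (X i - X (i + 1)) * divDiff i g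
      = g - rename (swap i (i + 1)) g := divDiff_spec i
  have ta : ∀ g : MvPolynomial ℕ ℤ, (X (i + 1) - X (i + 2)) * divDiff (i + 1) g
      = g - rename (swap (i + 1) (i + 2)) g := divDiff_spec (i + 1)
  have sX : ∀ p q g : MvPolynomial ℕ ℤ, p * q = g → rename (swap i (i + 1)) p *
      rename (swap i (i + 1)) q = rename (swap i (i + 1)) g := by
    intro p q g h
    rw [← map_mul, h]
  have tX : ∀ p q g : MvPolynomial ℕ ℤ, p * q = g → rename (swap (i + 1) (i + 2)) p *
      rename (swap (i + 1) (i + 2)) q = rename (swap (i + 1) (i + 2)) g := by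
    intro p q g h
    rw [← map_mul, h]
  have n1 : swap i (i + 1) (i + 2) = i + 2 := swap_apply_of_ne_of_ne (by omega) (by omega)
  have n2 : swap (i + 1) (i + 2) i = i := swap_apply_of_ne_of_ne (by omega) (by omega)
  have hac : (X i - X (i + 2) : MvPolynomial ℕ ℤ) ≠ 0 := by
    rw [sub_ne_zero]
    intro h
    have := X_injective h
    omega
  have A : (X i - X (i + 1)) * ((X (i + 1) - X (i + 2)) * ((X i - X (i + 2)) *
      divDiff i (divDiff (i + 1) (divDiff i f)))) =
      f - rename (swap i (i + 1)) f - rename (swap (i + 1) (i + 2)) f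
      + rename (swap (i + 1) (i + 2)) (rename (swap i (i + 1)) f)
      + rename (swap i (i + 1)) (rename (swap (i + 1) (i + 2)) f)
      - rename (swap i (i + 1)) (rename (swap (i + 1) (i + 2)) (rename (swap i (i + 1)) f)) := by
    have h1 := sa f
    have h2 := ta (divDiff i f)
    have h3 := sa (divDiff (i + 1) (divDiff i f))
    have h4 := sX _ _ _ h2
    have h5 := tX _ _ _ h1
    have h6 := sX _ _ _ h5
    simp only [map_sub, rename_X, swap_apply_left, swap_apply_right, n1, n2, rename_divDiff]
      at h4 h5 h6
    linear_combination (X (i + 1) - X (i + 2)) * (X i - X (i + 2)) * h3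
      + (X i - X (i + 2)) * h2 - (X (i + 1) - X (i + 2)) * h4 + h1 - h5 + h6
  have B : (X i - X (i + 1)) * ((X (i + 1) - X (i + 2)) * ((X i - X (i + 2)) *
      divDiff (i + 1) (divDiff i (divDiff (i + 1) f)))) =
      f - rename (swap i (i + 1)) f - rename (swap (i + 1) (i + 2)) f
      + rename (swap (i + 1) (i + 2)) (rename (swap i (i + 1)) f)
      + rename (swap i (i + 1)) (rename (swap (i + 1) (i + 2)) f)
      - rename (swap (i + 1) (i + 2)) (rename (swap i (i + 1))
        (rename (swap (i + 1) (i + 2)) f)) := by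
    have h1 := ta f
    have h2 := sa (divDiff (i + 1) f)
    have h3 := ta (divDiff i (divDiff (i + 1) f))
    have h4 := tX _ _ _ h2
    have h5 := sX _ _ _ h1
    have h6 := tX _ _ _ h5
    have r : rename (swap (i + 1) (i + 2)) (divDiff (i + 1) f) = divDiff (i + 1) f :=
      rename_divDiff (i + 1) f
    simp only [map_sub, rename_X, swap_apply_left, swap_apply_right, n1, n2, r]
      at h4 h5 h6
    linear_combination (X i - X (i + 1)) * (X i - X (i + 2)) * h3
      + (X i - X (i + 2)) * h2 - (X i - X (i + 1)) * h4 + h1 - h5 + h6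
  refine mul_left_cancel₀ hac (mul_left_cancel₀ (X_sub_X_succ_ne_zero (i + 1))
    (mul_left_cancel₀ (X_sub_X_succ_ne_zero i) ?_))
  rw [show i + 1 + 1 = i + 2 from rfl, A, B, e0]

theorem isHomogeneous_divDiff {i d : ℕ} {f : MvPolynomial ℕ ℤ} (hf : f.IsHomogeneous (d + 1)) :
    (divDiff i f).IsHomogeneous d := by
  have split : ∀ (d : ℕ) (s : ℕ →₀ ℕ), s.degree = d + 1 →
      ∃ j, s = (s - Finsupp.single j 1) + Finsupp.single j 1 ∧
        (s - Finsupp.single j 1).degree = d := by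
    intro d s hs
    obtain ⟨j, hj⟩ : ∃ j, s j ≠ 0 := by
      by_contra! h
      have : s = 0 := Finsupp.ext h
      simp [this] at hs
    have hs' : s = (s - Finsupp.single j 1) + Finsupp.single j 1 := by
      ext l
      by_cases hl : l = j
      · subst hl; simp; omega
      · simp [Ne.symm hl]
    have := congrArg Finsupp.degree hs'
    rw [map_add, Finsupp.degree_single] at this
    exact ⟨j, hs', by omega⟩
  have hmon : ∀ (d : ℕ) (s : ℕ →₀ ℕ) (a : ℤ), s.degree = d + 1 →
      (divDiff i (monomial s a)).IsHomogeneous d := by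
    intro d
    induction d with
    | zero =>
      intro s a hs
      obtain ⟨j, hj, h0⟩ := split 0 s hs
      rw [hj, monomial_add_single, pow_one, (Finsupp.degree_eq_zero_iff _).1 h0, ← C_apply,
        divDiff_mul_of_invariant _ (rename_C _ _)]
      have : (divDiff i (X j)).IsHomogeneous 0 := by
        by_cases h1 : j = i
        · rw [h1, divDiff_X_self]
          exact isHomogeneous_one _ _
        · by_cases h2 : j = i + 1
          · rw [h2, divDiff_X_succ]
            exact (isHomogeneous_one _ _).neg
          · rw [divDiff_X_of_ne h1 h2]
            exact isHomogeneous_zero _ _ _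
      simpa using (isHomogeneous_C ℕ a).mul this
    | succ d ih =>
      intro s a hs
      obtain ⟨j, hs', hdeg⟩ := split (d + 1) s hs
      rw [hs', monomial_add_single, pow_one, divDiff_mul]
      refine ((ih _ a hdeg).mul (isHomogeneous_X ℤ j)).add ?_
      have h1 : (rename (swap i (i + 1)) (monomial (s - Finsupp.single j 1) a)).IsHomogeneous
          (d + 1) := (isHomogeneous_monomial a hdeg).rename_isHomogeneous
      by_cases e1 : j = i
      · rw [e1] at h1 ⊢
        rw [divDiff_X_self, mul_one]; exact h1
      · by_cases e2 : j = i + 1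
        · rw [e2] at h1 ⊢
          rw [divDiff_X_succ, mul_neg, mul_one]; exact h1.neg
        · rw [divDiff_X_of_ne e1 e2, mul_zero]
          exact isHomogeneous_zero _ _ _
  rw [f.as_sum, divDiff_sum]
  refine IsHomogeneous.sum _ _ _ fun s hs => hmon d s _ ?_
  have := hf (mem_support_iff.1 hs)
  rwa [Finsupp.degree_eq_weight_one]

/-- Invariance under all s_i spreads a variable occurring in `f` to every later one, but only
finitely many variables occur. -/
theorem eq_C_of_forall_divDiff_eq_zero {f : MvPolynomial ℕ ℤ} (h : ∀ i, divDiff i f = 0) :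
    f = C (constantCoeff f) := by
  have hv : f.vars = ∅ := by
    by_contra hne
    obtain ⟨j, hj⟩ := Finset.nonempty_iff_ne_empty.2 hne
    have step : ∀ i, i ∈ f.vars → i + 1 ∈ f.vars := by
      intro i hi
      have h1 := divDiff_eq_zero_iff.1 (h i)
      have h2 := vars_rename (swap i (i + 1)) (rename (swap i (i + 1)) f)
      rw [rename_swap_swap, h1] at h2
      have h3 := h2 hi
      obtain ⟨l, hl, hli⟩ := Finset.mem_image.1 h3
      have : l = i + 1 := by
        have := congrArg (swap i (i + 1)) hli
        rwa [swap_apply_self, swap_apply_left] at this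
      exact this ▸ hl
    have all : ∀ n, j + n ∈ f.vars := fun n => by
      induction n with
      | zero => exact hj
      | succ n ih => exact step _ ih
    have := Finset.le_sup (f := id) (all (f.vars.sup id + 1))
    simp only [id] at this
    omega
  exact vars_eq_empty_iff_eq_C.1 hv

/-! ### Independence of the chosen ascent, and stability in n -/

theorem mul_swap_mem_symN {n i j : ℕ} {w : Perm ℕ} (hw : w ∈ symN n) (hi : i < n) (hj : j < n) :
    w * swap i j ∈ symN n := by
  refine (symN n).mul_mem hw fun l hl => ?_
  exact swap_apply_of_ne_of_ne (by omega) (by omega)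

theorem symN_mono {m n : ℕ} (h : m ≤ n) : symN m ≤ symN n := fun _ hw i hi => hw i (h.trans hi)

theorem lt_of_mem_symN {n i : ℕ} {w : Perm ℕ} (hw : w ∈ symN n) (hi : i < n) : w i < n := by
  by_contra! h
  have h1 := hw (w i) h
  have h2 := w.injective h1
  omega

/-- Frees the recursion from the choice of the first ascent. Two distant ascents are reconciled by
commuting operators; for two adjacent ones, both routes meet after three steps and the braid
relation applies. -/
theorem schubertIn_of_mem_ascents {n i : ℕ} {w : Perm ℕ} (hi : i ∈ ascents n w) :
    schubertIn n w = divDiff i (schubertIn n (w * swap i (i + 1))) := by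
  induction hm : ∑ j ∈ Finset.range n, j * w j using Nat.strong_induction_on generalizing w i with
  | _ m ih =>
    subst hm
    have ih' : ∀ (u : Perm ℕ) (j l : ℕ), j ∈ ascents n w → u = w * swap j (j + 1) →
        l ∈ ascents n u → schubertIn n u = divDiff l (schubertIn n (u * swap l (l + 1))) := by
      rintro u j l hj rfl hl
      exact ih _ (sum_mul_swap_lt n j w hj.1 hj.2) hl rfl
    have ih'' : ∀ (u : Perm ℕ) (j l r : ℕ), j ∈ ascents n w → l ∈ ascents n (w * swap j (j + 1)) →
        u = w * swap j (j + 1) * swap l (l + 1) → r ∈ ascents n u →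
        schubertIn n u = divDiff r (schubertIn n (u * swap r (r + 1))) := by
      rintro u j l r hj hl rfl hr
      exact ih _ ((sum_mul_swap_lt n l _ hl.1 hl.2).trans (sum_mul_swap_lt n j w hj.1 hj.2)) hr rfl
    have hne : (ascents n w).Nonempty := ⟨i, hi⟩
    have hdef : schubertIn n w = divDiff (firstAscent n w)
        (schubertIn n (w * swap (firstAscent n w) (firstAscent n w + 1))) := by
      rw [schubertIn, dif_pos hne]
    have hj : firstAscent n w ∈ ascents n w := Nat.sInf_mem hne
    rw [hdef]
    generalize firstAscent n w = j at hj
    have far : ∀ i j, i ∈ ascents n w → j ∈ ascents n w → i + 1 < j →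
        divDiff i (schubertIn n (w * swap i (i + 1)))
          = divDiff j (schubertIn n (w * swap j (j + 1))) := by
      intro i j hi hj hij
      have h1 : j ∈ ascents n (w * swap i (i + 1)) := by
        refine ⟨hj.1, ?_⟩
        rw [Perm.mul_apply, Perm.mul_apply, swap_apply_of_ne_of_ne (by omega) (by omega),
          swap_apply_of_ne_of_ne (by omega) (by omega)]
        exact hj.2
      have h2 : i ∈ ascents n (w * swap j (j + 1)) := by
        refine ⟨hi.1, ?_⟩
        rw [Perm.mul_apply, Perm.mul_apply, swap_apply_of_ne_of_ne (by omega) (by omega),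
          swap_apply_of_ne_of_ne (by omega) (by omega)]
        exact hi.2
      rw [ih' _ i j hi rfl h1, ih' _ j i hj rfl h2, divDiff_comm hij, mul_assoc, mul_assoc,
        swap_mul_swap_comm (by omega) (by omega) (by omega) (by omega)]
    have near : ∀ i, i ∈ ascents n w → i + 1 ∈ ascents n w →
        divDiff i (schubertIn n (w * swap i (i + 1)))
          = divDiff (i + 1) (schubertIn n (w * swap (i + 1) (i + 2))) := by
      intro i hi hj
      have a1 := hi.2
      have a2 : w (i + 1) < w (i + 2) := hj.2
      have a3 : i + 2 < n := hj.1
      have n1 : swap i (i + 1) (i + 2) = i + 2 := swap_apply_of_ne_of_ne (by omega) (by omega)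
      have n2 : swap (i + 1) (i + 2) i = i := swap_apply_of_ne_of_ne (by omega) (by omega)
      have h1 : i + 1 ∈ ascents n (w * swap i (i + 1)) := by
        refine ⟨a3, ?_⟩
        simp only [Perm.mul_apply, swap_apply_right, show i + 1 + 1 = i + 2 from rfl, n1]
        omega
      have h2 : i ∈ ascents n (w * swap i (i + 1) * swap (i + 1) (i + 2)) := by
        refine ⟨by omega, ?_⟩
        simp only [Perm.mul_apply, swap_apply_left, n1, n2]
        omega
      have h3 : i ∈ ascents n (w * swap (i + 1) (i + 2)) := by
        refine ⟨by omega, ?_⟩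
        simp only [Perm.mul_apply, swap_apply_left, n2]
        omega
      have h4 : i + 1 ∈ ascents n (w * swap (i + 1) (i + 2) * swap i (i + 1)) := by
        refine ⟨a3, ?_⟩
        simp only [Perm.mul_apply, swap_apply_right, show i + 1 + 1 = i + 2 from rfl, n1, n2]
        omega
      have e : w * swap i (i + 1) * swap (i + 1) (i + 2) * swap i (i + 1)
          = w * swap (i + 1) (i + 2) * swap i (i + 1) * swap (i + 1) (i + 2) := by
        have := swap_mul_swap_mul_swap (x := i) (y := i + 1) (z := i + 2) (by omega) (by omega)
        have h' := swap_mul_swap_mul_swap (x := i + 2) (y := i + 1) (z := i) (by omega) (by omega)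
        rw [swap_comm (i + 2) (i + 1), swap_comm (i + 1) i] at h'
        simp only [mul_assoc] at this h' ⊢
        rw [this, h', swap_comm (i + 2) i]
      rw [ih' _ i (i + 1) hi rfl h1, ih'' _ i (i + 1) i hi h1 rfl h2,
        ih' _ (i + 1) i hj rfl h3, ih'' _ (i + 1) i (i + 1) hj h3 rfl h4, divDiff_braid]
      exact congrArg (fun u => divDiff (i + 1) (divDiff i (divDiff (i + 1) (schubertIn n u)))) e
    rcases lt_trichotomy i j with h | rfl | h
    · rcases eq_or_lt_of_le (Nat.succ_le_of_lt h) with h | h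
      · subst h
        exact (near i hi hj).symm
      · exact (far i j hi hj h).symm
    · rfl
    · rcases eq_or_lt_of_le (Nat.succ_le_of_lt h) with h | h
      · subst h
        exact near j hj hi
      · exact far j i hj hi h

theorem divDiff_schubertIn_of_descent {n i : ℕ} {w : Perm ℕ} (hi : i + 1 < n)
    (h : w (i + 1) < w i) : divDiff i (schubertIn n w) = schubertIn n (w * swap i (i + 1)) := by
  have h1 : i ∈ ascents n (w * swap i (i + 1)) := by
    refine ⟨hi, ?_⟩
    simpa using h
  rw [schubertIn_of_mem_ascents h1, mul_assoc, swap_mul_self, mul_one]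

theorem divDiff_schubertIn_of_ascent {n i : ℕ} {w : Perm ℕ} (hi : i + 1 < n)
    (h : w i < w (i + 1)) : divDiff i (schubertIn n w) = 0 := by
  rw [schubertIn_of_mem_ascents ⟨hi, h⟩, divDiff_divDiff_self]

theorem apply_eq_of_ascents_eq_empty {n : ℕ} {w : Perm ℕ} (hw : w ∈ symN n)
    (h : ascents n w = ∅) {i : ℕ} (hi : i < n) : w i = n - 1 - i := by
  have hd : ∀ i, i + 1 < n → w (i + 1) < w i := by
    intro i hi
    have h1 : i ∉ ascents n w := by simp [h]
    have h2 : w i ≠ w (i + 1) := fun e => by have := w.injective e; omega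
    by_contra h3
    exact h1 ⟨hi, by omega⟩
  have up : ∀ i, i < n → w i ≤ n - 1 - i := by
    intro i
    induction i with
    | zero => intro h0; have := lt_of_mem_symN hw h0; omega
    | succ i ih => intro h0; have := ih (by omega); have := hd i h0; omega
  have down : ∀ d i, i < n → n - 1 - i = d → d ≤ w i := by
    intro d
    induction d with
    | zero => intros; omega
    | succ d ih =>
      intro i h0 h1
      have := ih (i + 1) (by omega) (by omega)
      have := hd i (by omega)
      omega
  have := up i hi
  have := down _ i hi rfl
  omega

theorem rename_swap_prod_X_pow {n j : ℕ} (hj : j + 1 < n) {e : ℕ → ℕ} (he : e (j + 1) = e j) :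
    rename (swap j (j + 1)) (∏ i ∈ Finset.range n, (X i : MvPolynomial ℕ ℤ) ^ e i)
      = ∏ i ∈ Finset.range n, X i ^ e i := by
  rw [map_prod]
  refine Finset.prod_equiv (swap j (j + 1)) (fun i => ?_) (fun i _ => ?_)
  · simp only [Finset.mem_range]
    rcases eq_or_ne i j with rfl | h1
    · rw [swap_apply_left]; omega
    · rcases eq_or_ne i (j + 1) with rfl | h2
      · rw [swap_apply_right]; omega
      · rw [swap_apply_of_ne_of_ne h1 h2]
  · rw [map_pow, rename_X]
    congr 1
    rcases eq_or_ne i j with rfl | h1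
    · rw [swap_apply_left, he]
    · rcases eq_or_ne i (j + 1) with rfl | h2
      · rw [swap_apply_right, he]
      · rw [swap_apply_of_ne_of_ne h1 h2]

/-- Here `u` is the longest element of S_n with the value `n` inserted at position `j`. For `j = 0`
it is the longest element of S_{n+1}. Each move of `n` from `j` to `j + 1` applies `divDiff j` to `X
j` times a monomial symmetric in x_j and x_{j+1}, which strips that factor. The case `j = n` gives
stability. -/
theorem schubertIn_succ_of_word {n : ℕ} (j : ℕ) (hj : j ≤ n) (u : Perm ℕ)
    (h1 : ∀ i < j, u i = n - 1 - i) (h2 : u j = n) (h3 : ∀ i, j < i → i ≤ n → u i = n - i) :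
    schubertIn (n + 1) u
      = ∏ i ∈ Finset.range (n + 1), X i ^ (if i < j then n - 1 - i else n - i) := by
  induction j generalizing u with
  | zero =>
    have : ¬ (ascents (n + 1) u).Nonempty := by
      rintro ⟨i, hi, hlt⟩
      rw [h3 (i + 1) (by omega) (by omega)] at hlt
      rcases Nat.eq_zero_or_pos i with rfl | h0
      · omega
      · rw [h3 i h0 (by omega)] at hlt; omega
    rw [schubertIn, dif_neg this]
    simp
  | succ j ih =>
    have hu : j ∈ ascents (n + 1) u := by
      refine ⟨by omega, ?_⟩
      rw [h2, h1 j (by omega)]; omega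
    rw [schubertIn_of_mem_ascents hu, ih (by omega) (u * swap j (j + 1))]
    · have e : (∏ i ∈ Finset.range (n + 1), X i ^ (if i < j then n - 1 - i else n - i) :
          MvPolynomial ℕ ℤ) = (∏ i ∈ Finset.range (n + 1),
            X i ^ (if i < j + 1 then n - 1 - i else n - i)) * X j := by
        have hj' : j ∈ Finset.range (n + 1) := Finset.mem_range.2 (by omega)
        rw [← Finset.mul_prod_erase _ _ hj', ← Finset.mul_prod_erase _ (fun i => X i ^ _) hj',
          if_neg (by omega), if_pos (by omega), mul_right_comm, ← pow_succ]
        congr 1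
        · congr 1; omega
        · refine Finset.prod_congr rfl fun i hi => ?_
          have := Finset.ne_of_mem_erase hi
          congr 1
          split_ifs <;> omega
      rw [e, divDiff_mul_of_invariant, divDiff_X_self, mul_one]
      refine rename_swap_prod_X_pow (by omega) ?_
      rw [if_neg (by omega), if_pos (by omega)]
      omega
    · intro i hi
      rw [Perm.mul_apply, swap_apply_of_ne_of_ne (by omega) (by omega), h1 i (by omega)]
    · rw [Perm.mul_apply, swap_apply_left, h2]
    · intro i hi hin
      rcases eq_or_ne i (j + 1) with rfl | hne
      · rw [Perm.mul_apply, swap_apply_right, h1 j (by omega)]; omega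
      · rw [Perm.mul_apply, swap_apply_of_ne_of_ne (by omega) hne, h3 i (by omega) hin]

theorem schubertIn_succ {n : ℕ} {w : Perm ℕ} (hw : w ∈ symN n) :
    schubertIn (n + 1) w = schubertIn n w := by
  induction hm : ∑ j ∈ Finset.range n, j * w j using Nat.strong_induction_on generalizing w with
  | _ m ih =>
    subst hm
    by_cases h : (ascents n w).Nonempty
    · obtain ⟨i, hi⟩ := h
      have hi1 := hi.1
      rw [schubertIn_of_mem_ascents hi,
        schubertIn_of_mem_ascents (n := n + 1) ⟨Nat.lt_succ_of_lt hi.1, hi.2⟩,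
        ih _ (sum_mul_swap_lt n i w hi.1 hi.2) (mul_swap_mem_symN hw (by omega) hi.1) rfl]
    · have hw0 := fun i => apply_eq_of_ascents_eq_empty hw (Set.not_nonempty_iff_eq_empty.1 h)
        (i := i)
      rw [schubertIn_succ_of_word n le_rfl w hw0 (hw n le_rfl) (by intros; omega), schubertIn,
        dif_neg h, Finset.prod_range_succ]
      simp only [lt_irrefl, if_false, tsub_self, pow_zero, mul_one]
      refine Finset.prod_congr rfl fun i hi => ?_
      rw [if_pos (Finset.mem_range.1 hi)]

theorem schubertIn_eq_of_le {m n : ℕ} (h : m ≤ n) {w : Perm ℕ} (hw : w ∈ symN m) :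
    schubertIn n w = schubertIn m w := by
  induction n, h using Nat.le_induction with
  | base => rfl
  | succ n hn ih => rw [schubertIn_succ (symN_mono hn hw), ih]

/-! ### Schubert polynomials on S_∞ and their dual functionals -/

open Classical in
/-- The Schubert polynomial of a permutation of `ℕ`, set to `0` outside `S_∞`. -/
noncomputable def sch (w : Perm ℕ) : MvPolynomial ℕ ℤ :=
  if h : w ∈ symInf then schubert ⟨w, h⟩ else 0

theorem sch_coe (w : symInf) : sch w = schubert w := by
  rw [sch, dif_pos w.2]

theorem mem_symInf_of_mem_symN {n : ℕ} {w : Perm ℕ} (hw : w ∈ symN n) : w ∈ symInf := ⟨n, hw⟩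

theorem sch_eq_schubertIn {n : ℕ} {w : Perm ℕ} (hw : w ∈ symN n) : sch w = schubertIn n w := by
  classical
  have h : w ∈ symInf := ⟨n, hw⟩
  rw [sch, dif_pos h, schubert]
  have h1 := Nat.find_min' h hw
  have h2 := Nat.find_spec h
  refine (schubertIn_eq_of_le ?_ ?_).symm
  · convert h1
  · convert h2

theorem swap_mem_symInf (i j : ℕ) : swap i j ∈ symInf :=
  ⟨max i j + 1, fun l hl => swap_apply_of_ne_of_ne
    (by have := le_max_left i j; omega) (by have := le_max_right i j; omega)⟩

theorem mul_swap_mem_symInf {w : Perm ℕ} (hw : w ∈ symInf) (i j : ℕ) : w * swap i j ∈ symInf :=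
  symInf.mul_mem hw (swap_mem_symInf i j)

theorem divDiff_sch_of_descent {i : ℕ} {w : Perm ℕ} (hw : w ∈ symInf) (h : w (i + 1) < w i) :
    divDiff i (sch w) = sch (w * swap i (i + 1)) := by
  obtain ⟨n, hn⟩ := hw
  have h1 : w ∈ symN (n + i + 2) := symN_mono (by omega) hn
  rw [sch_eq_schubertIn h1, divDiff_schubertIn_of_descent (by omega) h,
    sch_eq_schubertIn (mul_swap_mem_symN h1 (by omega) (by omega))]

theorem divDiff_sch_of_ascent {i : ℕ} {w : Perm ℕ} (hw : w ∈ symInf) (h : w i < w (i + 1)) :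
    divDiff i (sch w) = 0 := by
  obtain ⟨n, hn⟩ := hw
  have h1 : w ∈ symN (n + i + 2) := symN_mono (by omega) hn
  rw [sch_eq_schubertIn h1, divDiff_schubertIn_of_ascent (by omega) h]

theorem sch_one : sch 1 = 1 := by
  rw [sch_eq_schubertIn (n := 0) (fun _ _ => rfl), schubertIn, dif_neg]
  · simp
  · rintro ⟨i, hi, -⟩
    omega

theorem exists_descent_of_ne_one {w : Perm ℕ} (hw : w ∈ symInf) (h : w ≠ 1) :
    ∃ i, w (i + 1) < w i := by
  by_contra! hc
  have hmono : StrictMono w := strictMono_nat_of_lt_succ fun i =>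
    lt_of_le_of_ne (hc i) fun e => by have := w.injective e; omega
  obtain ⟨n, hn⟩ := hw
  refine h (Perm.ext fun i => ?_)
  have h1 : i ≤ w i := hmono.id_le i
  have h2 : ∀ d, w i + d ≤ w (i + d) := fun d => by
    induction d with
    | zero => exact le_rfl
    | succ d ih => have := hmono (show i + d < i + (d + 1) by omega); omega
  have h3 := h2 n
  rw [hn (i + n) (by omega)] at h3
  rw [Perm.one_apply]
  omega

/-- Induction on `S_∞` along descents. -/
theorem symInf_induction {P : Perm ℕ → Prop}
    (step : ∀ w ∈ symInf, (∀ i, w (i + 1) < w i → P (w * swap i (i + 1))) → P w)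
    (w : Perm ℕ) (hw : w ∈ symInf) : P w := by
  obtain ⟨n, hn⟩ := hw
  -- Removing a descent raises this sum, so a crude upper bound turns it into a decreasing measure.
  have bound : ∀ u ∈ symN n, ∑ j ∈ Finset.range n, j * u j ≤ n * (n * n) := by
    intro u hu
    calc ∑ j ∈ Finset.range n, j * u j ≤ ∑ _j ∈ Finset.range n, n * n :=
          Finset.sum_le_sum fun j hj => by
            have h1 := Finset.mem_range.1 hj
            exact Nat.mul_le_mul h1.le (lt_of_mem_symN hu h1).le
      _ = n * (n * n) := by simp
  induction hm : n * (n * n) - ∑ j ∈ Finset.range n, j * w j using Nat.strong_induction_on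
    generalizing w with
  | _ m ih =>
    subst hm
    refine step w ⟨n, hn⟩ fun i hi => ?_
    have hin : i + 1 < n := by
      by_contra hc
      rw [hn (i + 1) (by omega)] at hi
      by_cases h2 : i < n
      · have := lt_of_mem_symN hn h2; omega
      · rw [hn i (by omega)] at hi; omega
    have hn' := mul_swap_mem_symN hn (show i < n by omega) hin
    refine ih _ ?_ _ hn' rfl
    have h2 := sum_mul_swap_lt n i (w * swap i (i + 1)) hin (by simpa using hi)
    rw [mul_assoc, swap_mul_self, mul_one] at h2
    have h3 := bound _ hn'
    omega

/-- Induction on `S_∞` along one descent at a time. -/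
theorem symInf_descent_induction {P : Perm ℕ → Prop} (one : P 1)
    (step : ∀ w ∈ symInf, ∀ i, w (i + 1) < w i → P (w * swap i (i + 1)) → P w)
    (w : Perm ℕ) (hw : w ∈ symInf) : P w := by
  refine symInf_induction (fun w hw ih => ?_) w hw
  by_cases h : w = 1
  · exact h ▸ one
  · obtain ⟨i, hi⟩ := exists_descent_of_ne_one hw h
    exact step w hw i hi (ih i hi)

theorem sch_ne_zero {w : Perm ℕ} (hw : w ∈ symInf) : sch w ≠ 0 := by
  refine symInf_descent_induction (P := fun w => sch w ≠ 0) ?_ ?_ w hw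
  · rw [sch_one]; exact one_ne_zero
  · intro w hw i hi h h0
    rw [← divDiff_sch_of_descent hw hi, h0, divDiff_zero] at h
    exact h rfl

theorem divDiff_eq_zero_of_isHomogeneous_zero {i : ℕ} {f : MvPolynomial ℕ ℤ}
    (hf : f.IsHomogeneous 0) : divDiff i f = 0 := by
  rw [totalDegree_eq_zero_iff_eq_C.1 ((totalDegree_zero_iff_isHomogeneous _).2 hf), divDiff_C]

theorem exists_isHomogeneous_schubertIn (n : ℕ) (w : Perm ℕ) :
    ∃ d, (schubertIn n w).IsHomogeneous d := by
  induction hm : ∑ j ∈ Finset.range n, j * w j using Nat.strong_induction_on generalizing w with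
  | _ m ih =>
    subst hm
    by_cases h : (ascents n w).Nonempty
    · obtain ⟨i, hi⟩ := h
      rw [schubertIn_of_mem_ascents hi]
      obtain ⟨d, hd⟩ := ih _ (sum_mul_swap_lt n i w hi.1 hi.2) _ rfl
      cases d with
      | zero =>
        refine ⟨0, ?_⟩
        rw [divDiff_eq_zero_of_isHomogeneous_zero hd]
        exact isHomogeneous_zero _ _ _
      | succ d => exact ⟨d, isHomogeneous_divDiff hd⟩
    · rw [schubertIn, dif_neg h]
      exact ⟨_, IsHomogeneous.prod _ _ _ fun i _ => (isHomogeneous_X ℤ i).pow _⟩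

/-- By homogeneity a nonzero constant term would force degree 0, and then every divided difference
would vanish; at a descent, however, the result is another nonzero Schubert polynomial. -/
theorem constantCoeff_sch {w : Perm ℕ} (hw : w ∈ symInf) (h : w ≠ 1) :
    constantCoeff (sch w) = 0 := by
  obtain ⟨n, hn⟩ := id hw
  obtain ⟨d, hd⟩ := exists_isHomogeneous_schubertIn n w
  rw [← sch_eq_schubertIn hn] at hd
  by_contra h0
  have hd0 := hd h0
  rw [map_zero] at hd0
  subst hd0
  obtain ⟨i, hi⟩ := exists_descent_of_ne_one hw h
  refine sch_ne_zero (mul_swap_mem_symInf hw i (i + 1)) ?_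
  rw [← divDiff_sch_of_descent hw hi, divDiff_eq_zero_of_isHomogeneous_zero hd]

open Classical in
/-- The coefficient of a Schubert polynomial is an additive functional. -/
theorem exists_coeff_functional {v : Perm ℕ} (hv : v ∈ symInf) :
    ∃ L : MvPolynomial ℕ ℤ →+ ℤ, ∀ u ∈ symInf, L (sch u) = if u = v then 1 else 0 := by
  refine symInf_descent_induction (P := fun v => ∃ L : MvPolynomial ℕ ℤ →+ ℤ,
    ∀ u ∈ symInf, L (sch u) = if u = v then 1 else 0) ?_ ?_ v hv
  · refine ⟨(constantCoeff : MvPolynomial ℕ ℤ →+* ℤ).toAddMonoidHom, fun u hu => ?_⟩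
    split_ifs with h
    · simp [h, sch_one]
    · exact constantCoeff_sch hu h
  · rintro v hv i hi ⟨L, hL⟩
    -- Unwound, the functional applies the divided differences along a reduced word of `v` and takes
    -- the constant term.
    refine ⟨L.comp (divDiffHom i), fun u hu => ?_⟩
    rw [AddMonoidHom.comp_apply, divDiffHom_apply]
    rcases lt_trichotomy (u i) (u (i + 1)) with h | h | h
    · rw [divDiff_sch_of_ascent hu h, map_zero, if_neg]
      rintro rfl
      omega
    · have := u.injective h
      omega
    · rw [divDiff_sch_of_descent hu h, hL _ (mul_swap_mem_symInf hu _ _)]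
      simp only [mul_left_inj]

/-! ### Bruhat covers and Monk's rule -/

/-- Exchanging the entries of `u` in positions `a < b` is a cover in the Bruhat order. -/
def BruhatCover (u : Perm ℕ) (a b : ℕ) : Prop :=
  a < b ∧ u a < u b ∧ ∀ c, a < c → c < b → u c < u a ∨ u b < u c

theorem bruhatCover_succ {u : Perm ℕ} {i : ℕ} (h : u i < u (i + 1)) : BruhatCover u i (i + 1) :=
  ⟨by omega, h, by intros; omega⟩

theorem BruhatCover.ascent {u : Perm ℕ} {i a b : ℕ} (h : BruhatCover u a b)
    (hu : u i < u (i + 1)) (hne : ¬ (a = i ∧ b = i + 1)) :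
    (u * swap a b) i < (u * swap a b) (i + 1) := by
  obtain ⟨h1, h2, h3⟩ := h
  have e1 := h3 i
  have e2 := h3 (i + 1)
  simp only [Perm.mul_apply, swap_apply_def]
  grind

/-- Conjugation by s_i matches the covers of `u s_i`, other than the exchange of `i` and `i + 1`,
with exactly those covers of `u` that `divDiff i` does not kill. -/
theorem bruhatCover_mul_swap_iff {u : Perm ℕ} {i a b : ℕ} (hu : u (i + 1) < u i)
    (h1 : ¬ (a = i ∧ b = i + 1)) (h2 : ¬ (a = i + 1 ∧ b = i)) :
    BruhatCover (u * swap i (i + 1)) (swap i (i + 1) a) (swap i (i + 1) b) ↔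
      BruhatCover u a b ∧ (u * swap a b) (i + 1) < (u * swap a b) i := by
  have hlt : swap i (i + 1) a < swap i (i + 1) b ↔ a < b := by
    simp only [swap_apply_def]
    grind
  simp only [BruhatCover, Perm.mul_apply, swap_apply_self, hlt]
  constructor
  · rintro ⟨h3, h4, h5⟩
    have key : ∀ c, swap i (i + 1) a < swap i (i + 1) c → swap i (i + 1) c < swap i (i + 1) b →
        u c < u a ∨ u b < u c := by
      intro c hc hc'
      simpa using h5 (swap i (i + 1) c) hc hc'
    simp only [swap_apply_def] at key ⊢
    have k1 := key i
    have k2 := key (i + 1)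
    refine ⟨⟨h3, h4, fun c hc hc' => ?_⟩, ?_⟩
    · have k3 := key c
      grind
    · have : u a ≠ u b := by omega
      grind
  · rintro ⟨⟨h3, h4, h5⟩, h6⟩
    refine ⟨h3, h4, fun c hc hc' => ?_⟩
    have k1 := h5 i
    have k2 := h5 (i + 1)
    have k3 := h5 c
    simp only [swap_apply_def] at *
    grind

/-- Otherwise the fixed point `b - 1` would lie between the exchanged positions with an intermediate
value. This makes the sum in Monk's rule finite. -/
theorem BruhatCover.le_max {u : Perm ℕ} {n a b : ℕ} (h : BruhatCover u a b) (hu : u ∈ symN n) :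
    b ≤ max n (a + 1) := by
  obtain ⟨h1, h2, h3⟩ := h
  by_contra hc
  have hb := hu b (by omega)
  have hb' := hu (b - 1) (by omega)
  have h4 := h3 (b - 1) (by omega) (by omega)
  by_cases ha : a < n
  · have := lt_of_mem_symN hu ha
    omega
  · have := hu a (by omega)
    omega

open Classical in
/-- The Schubert polynomial of the cover of `u` obtained by exchanging positions `a < b`. -/
noncomputable def coverSch (u : Perm ℕ) (a b : ℕ) : MvPolynomial ℕ ℤ :=
  if BruhatCover u a b then sch (u * swap a b) else 0

theorem divDiff_coverSch_of_ascent {u : Perm ℕ} (hu : u ∈ symInf) {i a b : ℕ}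
    (h : u i < u (i + 1)) (hne : ¬ (a = i ∧ b = i + 1)) : divDiff i (coverSch u a b) = 0 := by
  rw [coverSch]
  split_ifs with hc
  · exact divDiff_sch_of_ascent (mul_swap_mem_symInf hu _ _) (hc.ascent h hne)
  · exact divDiff_zero i

theorem divDiff_coverSch_self {u : Perm ℕ} (hu : u ∈ symInf) {i : ℕ} (h : u i < u (i + 1)) :
    divDiff i (coverSch u i (i + 1)) = sch u := by
  rw [coverSch, if_pos (bruhatCover_succ h), divDiff_sch_of_descent (mul_swap_mem_symInf hu _ _),
    mul_assoc, swap_mul_self, mul_one]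
  simpa using h

theorem divDiff_coverSch_of_descent {u : Perm ℕ} (hu : u ∈ symInf) {i a b : ℕ}
    (h : u (i + 1) < u i) (h1 : ¬ (a = i ∧ b = i + 1)) (h2 : ¬ (a = i + 1 ∧ b = i)) :
    divDiff i (coverSch u a b)
      = coverSch (u * swap i (i + 1)) (swap i (i + 1) a) (swap i (i + 1) b) := by
  have hm := mul_swap_mem_symInf hu a b
  have hiff := bruhatCover_mul_swap_iff h h1 h2
  by_cases hc : BruhatCover u a b
  · rw [coverSch, if_pos hc, coverSch]
    by_cases hd : (u * swap a b) (i + 1) < (u * swap a b) i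
    · rw [if_pos (hiff.2 ⟨hc, hd⟩), divDiff_sch_of_descent hm hd, mul_assoc, mul_assoc]
      congr 2
      rw [swap_mul_eq_mul_swap, swap_inv]
    · rw [if_neg fun h' => hd (hiff.1 h').2]
      refine divDiff_sch_of_ascent hm (lt_of_le_of_ne (not_lt.1 hd) fun e => ?_)
      have := (u * swap a b).injective e
      omega
  · rw [coverSch, if_neg hc, coverSch, if_neg fun h' => hc (hiff.1 h').1, divDiff_zero]

theorem coverSch_eq_zero_of_le {u : Perm ℕ} {a b : ℕ} (h : b ≤ a) : coverSch u a b = 0 :=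
  if_neg fun h' => by have := h'.1; omega

theorem coverSch_eq_zero_of_descent {u : Perm ℕ} {a b : ℕ} (h : u b < u a) :
    coverSch u a b = 0 :=
  if_neg fun h' => by have := h'.2.1; omega

theorem constantCoeff_coverSch {u : Perm ℕ} (hu : u ∈ symInf) (a b : ℕ) :
    constantCoeff (coverSch u a b) = 0 := by
  rw [coverSch]
  split_ifs with h
  · refine constantCoeff_sch (mul_swap_mem_symInf hu _ _) fun e => ?_
    have hlt := h.1
    have h1 := h.2.1
    have h2 := Perm.congr_fun e a
    have h3 := Perm.congr_fun e b
    rw [Perm.mul_apply, swap_apply_left, Perm.one_apply] at h2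
    rw [Perm.mul_apply, swap_apply_right, Perm.one_apply] at h3
    omega
  · simp

/-- Monk's rule for the product with a variable. -/
theorem X_mul_sch (u : Perm ℕ) (hu : u ∈ symInf) : ∀ k n N : ℕ, u ∈ symN n → n < N → k + 1 < N →
    X k * sch u = ∑ j ∈ Finset.range N, (coverSch u k j - coverSch u j k) := by
  refine symInf_induction (P := fun u => ∀ k n N : ℕ, u ∈ symN n → n < N → k + 1 < N →
    X k * sch u = ∑ j ∈ Finset.range N, (coverSch u k j - coverSch u j k)) ?_ u hu
  clear! u
  intro u hu ih k n N hn hN hk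
  have extend : ∀ (u : Perm ℕ) (n N N' : ℕ), u ∈ symN n → n < N → k + 1 < N → N ≤ N' →
      ∑ j ∈ Finset.range N, (coverSch u k j - coverSch u j k)
        = ∑ j ∈ Finset.range N', (coverSch u k j - coverSch u j k) := by
    intro u n N N' hn hN hk hNN
    refine Finset.sum_subset (Finset.range_mono hNN) fun j _ hj => ?_
    rw [Finset.mem_range, not_lt] at hj
    rw [coverSch_eq_zero_of_le (a := j) (by omega), sub_zero, coverSch,
      if_neg fun h => ?_]
    have := h.le_max hn
    omega
  rw [← sub_eq_zero]
  -- It suffices that all divided differences of the two sides agree, since both constant terms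
  -- vanish. The range is enlarged to `N + i + 2` so that s_i permutes it.
  have hconst : ∀ i, divDiff i (X k * sch u
      - ∑ j ∈ Finset.range N, (coverSch u k j - coverSch u j k)) = 0 := by
    intro i
    rw [extend u n N (N + i + 2) hn hN hk (by omega), divDiff_sub, divDiff_mul, divDiff_sum,
      rename_X, sub_eq_zero]
    simp only [divDiff_sub]
    set M := N + i + 2 with hM
    have him : i ∈ Finset.range M := Finset.mem_range.2 (by omega)
    have him' : i + 1 ∈ Finset.range M := Finset.mem_range.2 (by omega)
    rcases lt_trichotomy (u i) (u (i + 1)) with h | h | h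
    · rw [divDiff_sch_of_ascent hu h, mul_zero, add_zero]
      by_cases h1 : k = i
      · subst h1
        rw [divDiff_X_self, one_mul, Finset.sum_eq_single (k + 1), divDiff_coverSch_self hu h,
          divDiff_coverSch_of_ascent hu h (by omega), sub_zero]
        · intro j _ hj
          rw [divDiff_coverSch_of_ascent hu h (by omega),
            divDiff_coverSch_of_ascent hu h (by omega), sub_zero]
        · exact fun h => absurd him' h
      · by_cases h2 : k = i + 1
        · subst h2
          rw [divDiff_X_succ, neg_one_mul, Finset.sum_eq_single i, divDiff_coverSch_self hu h,
            divDiff_coverSch_of_ascent hu h (by omega), zero_sub]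
          · intro j _ hj
            rw [divDiff_coverSch_of_ascent hu h (by omega),
              divDiff_coverSch_of_ascent hu h (by omega), sub_zero]
          · exact fun h => absurd him h
        · rw [divDiff_X_of_ne h1 h2, zero_mul, Finset.sum_eq_zero]
          intro j _
          rw [divDiff_coverSch_of_ascent hu h (by omega),
            divDiff_coverSch_of_ascent hu h (by omega), sub_zero]
    · have := u.injective h
      omega
    -- The twisted Leibniz rule leaves `X (s_i k)` times the Schubert polynomial of `u s_i`, to
    -- which induction applies. The exchange of `i` and `i + 1`, a cover of `u s_i` but not of `u`,
    -- gives back `sch u` and cancels the term from `divDiff i (X k)` when that is nonzero.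
    · have hn' : u * swap i (i + 1) ∈ symN (N + i + 2 - 1) :=
        mul_swap_mem_symN (symN_mono (by omega) hn) (by omega) (by omega)
      have hsk : swap i (i + 1) k + 1 < M := by
        rw [swap_apply_def]
        split_ifs <;> omega
      rw [divDiff_sch_of_descent hu h, ih i h (swap i (i + 1) k) (N + i + 2 - 1) M hn' (by omega)
        hsk]
      have hlow : (u * swap i (i + 1)) i < (u * swap i (i + 1)) (i + 1) := by simpa using h
      have hself : coverSch (u * swap i (i + 1)) i (i + 1) = sch u := by
        rw [coverSch, if_pos (bruhatCover_succ hlow), mul_assoc, swap_mul_self, mul_one]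
      have reindex : ∀ f : ℕ → MvPolynomial ℕ ℤ,
          ∑ j ∈ Finset.range M, f j = ∑ j ∈ Finset.range M, f (swap i (i + 1) j) := by
        intro f
        refine (Finset.sum_equiv (swap i (i + 1)) (fun j => ?_) fun j _ => rfl).symm
        simp only [Finset.mem_range]
        rw [swap_apply_def]
        split_ifs <;> omega
      rw [reindex]
      by_cases h1 : k = i
      · subst h1
        rw [divDiff_X_self, one_mul, ← Finset.add_sum_erase _ _ him',
          ← Finset.add_sum_erase (Finset.range M) (fun j => divDiff k (coverSch u k j) - _) him',
          ← add_assoc]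
        congr 1
        · rw [swap_apply_left, swap_apply_right, hself, coverSch_eq_zero_of_le (by omega),
            coverSch_eq_zero_of_descent h, coverSch_eq_zero_of_le (by omega), divDiff_zero]
          ring
        · refine Finset.sum_congr rfl fun j hj => ?_
          have := Finset.ne_of_mem_erase hj
          rw [divDiff_coverSch_of_descent hu h (by omega) (by omega),
            divDiff_coverSch_of_descent hu h (by omega) (by omega)]
      · by_cases h2 : k = i + 1
        · subst h2
          rw [divDiff_X_succ, neg_one_mul, ← Finset.add_sum_erase _ _ him,
            ← Finset.add_sum_erase (Finset.range M)
              (fun j => divDiff i (coverSch u (i + 1) j) - _) him, ← add_assoc]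
          congr 1
          · rw [swap_apply_left, swap_apply_right, hself, coverSch_eq_zero_of_le (by omega),
              coverSch_eq_zero_of_descent h, coverSch_eq_zero_of_le (by omega), divDiff_zero]
            ring
          · refine Finset.sum_congr rfl fun j hj => ?_
            have := Finset.ne_of_mem_erase hj
            rw [divDiff_coverSch_of_descent hu h (by omega) (by omega),
              divDiff_coverSch_of_descent hu h (by omega) (by omega)]
        · rw [divDiff_X_of_ne h1 h2, zero_mul, zero_add]
          refine Finset.sum_congr rfl fun j hj => ?_
          rw [divDiff_coverSch_of_descent hu h (by omega) (by omega),
            divDiff_coverSch_of_descent hu h (by omega) (by omega)]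
  rw [eq_C_of_forall_divDiff_eq_zero hconst, map_sub, map_mul, constantCoeff_X, zero_mul, map_sum,
    Finset.sum_eq_zero, sub_zero, C_0]
  intro j _
  rw [map_sub, constantCoeff_coverSch hu, constantCoeff_coverSch hu, sub_zero]

/-! ### Pieri chains and their uniqueness -/

/-- The permutation reached from `w` by exchanging the pairs of positions in `l`, the last entry of
the list first. -/
def chainPerm (w : Perm ℕ) : List (ℕ × ℕ) → Perm ℕ
  | [] => w
  | p :: l => chainPerm w l * swap p.1 p.2

/-- A Pieri chain: a saturated chain in the `k`-Bruhat order in which the larger of the exchanged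
values increases strictly. -/
def PieriChain (k : ℕ) (w : Perm ℕ) : List (ℕ × ℕ) → Prop
  | [] => True
  | p :: l => PieriChain k w l ∧ p.1 < k ∧ k ≤ p.2 ∧ BruhatCover (chainPerm w l) p.1 p.2 ∧
      ∀ q ∈ l, w q.2 < w p.2

theorem chainPerm_append (w : Perm ℕ) (l m : List (ℕ × ℕ)) :
    chainPerm w (l ++ m) = chainPerm (chainPerm w m) l := by
  induction l with
  | nil => rfl
  | cons p l ih => rw [List.cons_append, chainPerm, chainPerm, ih]

theorem chainPerm_cons_apply_fst (w : Perm ℕ) (a b : ℕ) (l : List (ℕ × ℕ)) :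
    chainPerm w ((a, b) :: l) a = chainPerm w l b := by
  rw [chainPerm, Perm.mul_apply, swap_apply_left]

theorem chainPerm_cons_apply_snd (w : Perm ℕ) (a b : ℕ) (l : List (ℕ × ℕ)) :
    chainPerm w ((a, b) :: l) b = chainPerm w l a := by
  rw [chainPerm, Perm.mul_apply, swap_apply_right]

theorem chainPerm_cons_apply_of_ne (w : Perm ℕ) {a b x : ℕ} (l : List (ℕ × ℕ)) (ha : x ≠ a)
    (hb : x ≠ b) : chainPerm w ((a, b) :: l) x = chainPerm w l x := by
  rw [chainPerm, Perm.mul_apply, swap_apply_of_ne_of_ne ha hb]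

namespace PieriChain

variable {k : ℕ} {w : Perm ℕ} {l m : List (ℕ × ℕ)}

theorem le_snd (h : PieriChain k w l) {x : ℕ} (hx : x ∈ l.map Prod.snd) : k ≤ x := by
  induction l with
  | nil => simp at hx
  | cons p l ih =>
    obtain ⟨h1, -, h3, -⟩ := h
    rw [List.map_cons, List.mem_cons] at hx
    rcases hx with rfl | hx
    · exact h3
    · exact ih h1 hx

/-- Repeating a position would repeat its label `w p.2`, against strict increase. Hence a position ≥
`k` keeps its starting value until its only exchange, and the labels are the values actually moved.
-/
theorem snd_not_mem {p : ℕ × ℕ} (h : PieriChain k w (p :: l)) : p.2 ∉ l.map Prod.snd := by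
  intro hm
  obtain ⟨q, hq, e⟩ := List.mem_map.1 hm
  have := h.2.2.2.2 q hq
  rw [e] at this
  exact lt_irrefl _ this

theorem apply_of_not_mem_snd (h : PieriChain k w l) {x : ℕ} (hk : k ≤ x)
    (hx : x ∉ l.map Prod.snd) : chainPerm w l x = w x := by
  induction l with
  | nil => rfl
  | cons p l ih =>
    obtain ⟨h1, h2, -⟩ := h
    rw [List.map_cons, List.mem_cons, not_or] at hx
    rw [chainPerm_cons_apply_of_ne _ _ (by omega) hx.1]
    exact ih h1 hx.2

theorem apply_snd_of_cons {a b : ℕ} (h : PieriChain k w ((a, b) :: l)) :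
    chainPerm w l b = w b :=
  h.1.apply_of_not_mem_snd h.2.2.1 h.snd_not_mem

theorem apply_of_not_mem_fst (h : PieriChain k w l) {x : ℕ} (hk : x < k)
    (hx : x ∉ l.map Prod.fst) : chainPerm w l x = w x := by
  induction l with
  | nil => rfl
  | cons p l ih =>
    obtain ⟨h1, -, h2, -⟩ := h
    rw [List.map_cons, List.mem_cons, not_or] at hx
    rw [chainPerm_cons_apply_of_ne _ _ hx.1 (by omega)]
    exact ih h1 hx.2

theorem apply_lt_of_mem_snd (h : PieriChain k w l) {x : ℕ} (hx : x ∈ l.map Prod.snd) :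
    chainPerm w l x < w x := by
  induction l with
  | nil => simp at hx
  | cons p l ih =>
    obtain ⟨a, b⟩ := p
    have hk := h.le_snd hx
    have hb := h.apply_snd_of_cons
    obtain ⟨h1, h2, h3, h4, -⟩ := h
    by_cases hxb : x = b
    · subst hxb
      rw [chainPerm_cons_apply_snd, ← hb]
      exact h4.2.1
    · rw [chainPerm_cons_apply_of_ne _ _ (by simp only at h2; omega) hxb]
      refine ih h1 ?_
      rw [List.map_cons, List.mem_cons] at hx
      exact hx.resolve_left hxb

theorem apply_le (h : PieriChain k w l) {x : ℕ} (hx : k ≤ x) : chainPerm w l x ≤ w x := by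
  by_cases hm : x ∈ l.map Prod.snd
  · exact (h.apply_lt_of_mem_snd hm).le
  · exact (h.apply_of_not_mem_snd hx hm).le

theorem apply_eq_or (h : PieriChain k w l) {a : ℕ} (ha : a < k) :
    chainPerm w l a = w a ∨ ∃ q ∈ l, q.1 = a ∧ chainPerm w l a = w q.2 := by
  induction l with
  | nil => exact Or.inl rfl
  | cons p l ih =>
    obtain ⟨c, b⟩ := p
    have hb := h.apply_snd_of_cons
    by_cases hac : a = c
    · subst hac
      exact Or.inr ⟨(a, b), by simp, rfl, by rw [chainPerm_cons_apply_fst, hb]⟩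
    · have h3 : k ≤ b := h.2.2.1
      rw [chainPerm_cons_apply_of_ne _ _ hac (by omega)]
      rcases ih h.1 with h' | ⟨q, hq, h'⟩
      · exact Or.inl h'
      · exact Or.inr ⟨q, List.mem_cons_of_mem _ hq, h'⟩

theorem le_apply (h : PieriChain k w l) {a : ℕ} (ha : a < k) : w a ≤ chainPerm w l a := by
  induction l with
  | nil => exact le_rfl
  | cons p l ih =>
    obtain ⟨c, b⟩ := p
    refine (ih h.1).trans ?_
    by_cases hac : a = c
    · subst hac
      rw [chainPerm_cons_apply_fst]
      exact h.2.2.2.1.2.1.le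
    · have h3 : k ≤ b := h.2.2.1
      rw [chainPerm_cons_apply_of_ne _ _ hac (by omega)]

/-- The labels of the later part `l` are the same read from `w` or from `chainPerm w m`, because its
positions ≥ `k` have not been touched by `m`. -/
theorem append (h : PieriChain k w (l ++ m)) :
    PieriChain k w m ∧ PieriChain k (chainPerm w m) l := by
  induction l with
  | nil => exact ⟨h, trivial⟩
  | cons p l ih =>
    rw [List.cons_append] at h
    have hlab : ∀ q ∈ p :: l, chainPerm w m q.2 = w q.2 := by
      have aux : ∀ l : List (ℕ × ℕ), PieriChain k w (l ++ m) → ∀ q ∈ l,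
          chainPerm w m q.2 = w q.2 := by
        intro l
        induction l with
        | nil => simp
        | cons p l ih' =>
          intro h q hq
          rcases List.mem_cons.1 hq with rfl | hq
          · have hm : PieriChain k w m := by
              clear ih' hq ih
              have := h.1
              clear h
              induction l with
              | nil => exact this
              | cons p l ih'' => exact ih'' this.1
            refine hm.apply_of_not_mem_snd h.2.2.1 fun hmem => h.snd_not_mem ?_
            change q.2 ∈ List.map Prod.snd (l ++ m)
            rw [List.map_append, List.mem_append]
            exact Or.inr hmem
          · exact ih' h.1 q hq
      exact aux (p :: l) h
    obtain ⟨h1, h2, h3, h4, h5⟩ := h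
    obtain ⟨i1, i2⟩ := ih h1
    refine ⟨i1, i2, h2, h3, ?_, fun q hq => ?_⟩
    · rwa [← chainPerm_append]
    · rw [hlab q (List.mem_cons_of_mem _ hq), hlab p List.mem_cons_self]
      exact h5 q (List.mem_append_left _ hq)

/-- Position `c` lies between `a` and any position ≥ `k`, so the cover condition forbids lifting `a`
past the value at `c` in one exchange. -/
theorem ascent (h : PieriChain k w l) {a c : ℕ} (hac : a < c) (hc : c < k) (hlt : w a < w c) :
    chainPerm w l a < chainPerm w l c := by
  induction l with
  | nil => exact hlt
  | cons p l ih =>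
    obtain ⟨x, b⟩ := p
    have := ih h.1
    obtain ⟨h1, h2, h3, ⟨h4, h5, h6⟩, -⟩ := h
    simp only at h2 h3 h4 h5 h6
    by_cases hax : a = x
    · subst hax
      rw [chainPerm_cons_apply_fst, chainPerm_cons_apply_of_ne _ _ (by omega) (by omega)]
      have := h6 c hac (by omega)
      omega
    · rw [chainPerm_cons_apply_of_ne _ _ hax (by omega)]
      by_cases hcx : c = x
      · subst hcx
        rw [chainPerm_cons_apply_fst]
        omega
      · rwa [chainPerm_cons_apply_of_ne _ _ hcx (by omega)]

/-- To rise above a level `y` not exceeding the value in a later position `c`, the position `a`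
has to receive a value smaller than the initial one in position `c`. -/
theorem exists_jump (h : PieriChain k w l) {a c y : ℕ} (hac : a < c) (hc : c < k)
    (ha : w a < y) (hy : y ≤ w c) (hl : y ≤ chainPerm w l a) :
    ∃ b, y ≤ w b ∧ w b < w c := by
  induction l with
  | nil => exact absurd hl (not_le.2 ha)
  | cons p l ih =>
    obtain ⟨x, b⟩ := p
    by_cases hlt : y ≤ chainPerm w l a
    · exact ih h.1 hlt
    · have hb := h.apply_snd_of_cons
      have hx : k ≤ b := h.2.2.1
      have hax : a = x := by
        by_contra hne
        rw [chainPerm_cons_apply_of_ne _ _ hne (by omega)] at hl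
        exact hlt hl
      subst hax
      rw [chainPerm_cons_apply_fst, hb] at hl
      -- At the exchange that lifts `a` to level `y`, position `c` lies between with a larger value,
      -- which the cover condition forces above `w b`. A label received earlier by `c` would be
      -- below `w b`, so `c` still holds `w c`.
      have h6 := h.2.2.2.1.2.2 c hac (show c < b by omega)
      simp only [hb] at h6
      have h7 := h.1.le_apply hc
      refine ⟨b, hl, ?_⟩
      rcases h.1.apply_eq_or hc with h8 | ⟨q, hq, -, h8⟩
      · omega
      · have : w q.2 < w b := h.2.2.2.2 q hq
        omega

/-- When `c` first rises above `w a`, it receives the largest label so far, while `a` holds `w a` or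
an earlier label. From then on `ascent` preserves the order. -/
theorem lt_of_lt_apply (h : PieriChain k w l) {a c : ℕ} (hac : a < c) (hc : c < k)
    (hlt : w a < chainPerm w l c) : chainPerm w l a < chainPerm w l c := by
  induction l with
  | nil => exact hlt
  | cons p l ih =>
    obtain ⟨x, b⟩ := p
    by_cases h0 : w a < chainPerm w l c
    · have h1 : PieriChain k (chainPerm w l) [(x, b)] := (append (l := [(x, b)]) h).2
      exact h1.ascent hac hc (ih h.1 h0)
    · have hb := h.apply_snd_of_cons
      have hx : k ≤ b := h.2.2.1
      have hcx : c = x := by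
        by_contra hne
        rw [chainPerm_cons_apply_of_ne _ _ hne (by omega)] at hlt
        exact h0 hlt
      subst hcx
      rw [chainPerm_cons_apply_fst, hb] at hlt ⊢
      rw [chainPerm_cons_apply_of_ne _ _ (by omega) (by omega)]
      rcases h.1.apply_eq_or (hac.trans hc) with h8 | ⟨q, hq, -, h8⟩
      · omega
      · have : w q.2 < w b := h.2.2.2.2 q hq
        omega

/-- The first exchange of `a` drops its starting value into a position that is never used again.
That position depends on `l` alone, so it serves for two chains with the same list but different
starting points. -/
theorem exists_snd_apply_eq (h : PieriChain k w l) {a : ℕ} (ha : a ∈ l.map Prod.fst) :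
    ∃ b ∈ l.map Prod.snd, ∀ u, PieriChain k u l → chainPerm u l b = u a := by
  induction l with
  | nil => simp at ha
  | cons p l ih =>
    by_cases hm : a ∈ l.map Prod.fst
    · obtain ⟨b, hb, hu⟩ := ih h.1 hm
      have hkb := h.1.le_snd hb
      refine ⟨b, List.mem_cons_of_mem _ hb, fun u hc => ?_⟩
      have h2 := h.2.1
      have h3 : b ≠ p.2 := fun e => h.snd_not_mem (e ▸ hb)
      rw [show p = (p.1, p.2) from rfl, chainPerm_cons_apply_of_ne _ _ (by omega) h3]
      exact hu u hc.1
    · rw [List.map_cons, List.mem_cons] at ha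
      have ha := ha.resolve_right hm
      refine ⟨p.2, by simp, fun u hc => ?_⟩
      rw [show p = (p.1, p.2) from rfl, chainPerm_cons_apply_snd, ← ha]
      exact hc.1.apply_of_not_mem_fst (ha ▸ h.2.1) hm

end PieriChain

/-- The head of a list is the last exchange, so `r` is the common final part of the two chains. -/
theorem exists_last_difference {l l' : List (ℕ × ℕ)} (h : l.map Prod.snd = l'.map Prod.snd)
    (hne : l ≠ l') : ∃ r t t' a a' b, l = r ++ (a, b) :: t ∧ l' = r ++ (a', b) :: t' ∧
      a ≠ a' := by
  induction l generalizing l' with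
  | nil =>
    cases l' with
    | nil => exact absurd rfl hne
    | cons => simp at h
  | cons p l ih =>
    cases l' with
    | nil => simp at h
    | cons p' l' =>
      obtain ⟨a, b⟩ := p
      obtain ⟨a', b'⟩ := p'
      simp only [List.map_cons, List.cons.injEq] at h
      obtain ⟨rfl, h⟩ := h
      by_cases ha : a = a'
      · subst ha
        obtain ⟨r, t, t', c, c', d, e, e', h1⟩ := ih h (fun e => hne (by rw [e]))
        exact ⟨(a, b) :: r, t, t', c, c', d, by rw [e]; rfl, by rw [e']; rfl, h1⟩
      · exact ⟨[], l, l', a, a', b, rfl, rfl, ha⟩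

/-- At the last difference one chain puts the value `w b` at `c`, the other at `a < c`. The second
forces the final value at `a` to be at least `w b`; in the first, `a` starts below `w b` and is
blocked by the value `w b` to its right. Following `w b` through `r` and `m` shows that the blockade
is never lifted. -/
theorem pieriChain_difference_aux {k : ℕ} {w : Perm ℕ} {r t t' m m' : List (ℕ × ℕ)} {a c b : ℕ}
    (hl : PieriChain k w (r ++ (c, b) :: t)) (hl' : PieriChain k w (r ++ (a, b) :: t'))
    (hac : a < c)
    (hm : PieriChain k (chainPerm w (r ++ (c, b) :: t)) m)
    (hm' : PieriChain k (chainPerm w (r ++ (a, b) :: t')) m')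
    (hv : chainPerm (chainPerm w (r ++ (c, b) :: t)) m
      = chainPerm (chainPerm w (r ++ (a, b) :: t')) m') : False := by
  obtain ⟨hc1, hr⟩ := hl.append
  obtain ⟨hc1', hr'⟩ := hl'.append
  rw [chainPerm_append] at hm hm' hv
  rw [chainPerm_append w r ((a, b) :: t')] at hv
  have hck : c < k := hc1.2.1
  have hak : a < k := hac.trans hck
  have hkb : k ≤ b := hc1.2.2.1
  set s := chainPerm w ((c, b) :: t) with hs
  set s' := chainPerm w ((a, b) :: t') with hs'
  set u := chainPerm s r with hu
  set u' := chainPerm s' r with hu'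
  have hsc : s c = w b := by rw [hs, chainPerm_cons_apply_fst, hc1.apply_snd_of_cons]
  have hsa' : s' a = w b := by rw [hs', chainPerm_cons_apply_fst, hc1'.apply_snd_of_cons]
  have hsc' : s' c = chainPerm w t' c := chainPerm_cons_apply_of_ne _ _ (by omega) (by omega)
  have hcov' := hc1'.2.2.2.1
  have hxb' := hc1'.apply_snd_of_cons
  have hwa : w a < w b := (hc1'.1.le_apply hak).trans_lt (hxb' ▸ hcov'.2.1)
  have hwc : w c < w b :=
    (hc1.1.le_apply hck).trans_lt (hc1.apply_snd_of_cons ▸ hc1.2.2.2.1.2.1)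
  have hlab : ∀ q ∈ t, w q.2 < w b := hc1.2.2.2.2
  have hlab' : ∀ q ∈ t', w q.2 < w b := hc1'.2.2.2.2
  have hsa : s a < w b := by
    rw [hs, chainPerm_cons_apply_of_ne _ _ (by omega) (by omega)]
    rcases hc1.1.apply_eq_or hak with h | ⟨q, hq, -, h⟩
    · omega
    · have := hlab q hq; omega
  have hq : s' c < w b := by
    rw [hsc']
    rcases hc1'.1.apply_eq_or hck with h | ⟨q, hq, -, h⟩
    · omega
    · have := hlab' q hq; omega
  -- While `c` starts at `w b`, `exists_jump` would need a label that is ≥ `w b` and < `w b`.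
  have hua : u a < w b := by
    by_contra hcon
    obtain ⟨_, h1, h2⟩ := hr.exists_jump hac hck hsa hsc.ge (not_lt.1 hcon)
    omega
  have huc : w b ≤ u c := hsc ▸ hr.le_apply hck
  have hva : w b ≤ chainPerm u m a := by
    rw [hv, ← hsa']
    exact (hr'.le_apply hak).trans (hm'.le_apply hak)
  obtain ⟨_, h1, h2⟩ := hm.exists_jump hac hck hua huc hva
  -- During `m` the position `a` does jump, which requires `u c > w b`; so `r` has moved `c`,
  -- leaving `w b` in some position `β`. In the other chain the same `β` receives `s' c`.
  have hcr : c ∈ r.map Prod.fst := by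
    by_contra hcon
    have : u c = s c := hr.apply_of_not_mem_fst hck hcon
    omega
  obtain ⟨β, hβ, hβu⟩ := hr.exists_snd_apply_eq hcr
  have hkβ := hr.le_snd hβ
  have huβ : u β = w b := (hβu s hr).trans hsc
  have huβ' : u' β = s' c := hβu s' hr'
  have hvβ : chainPerm u m β ≤ s' c := by
    rw [hv, ← huβ']
    exact hm'.apply_le hkβ
  -- In the other chain `c` lies between `a` and `b` when they are exchanged, so its value is below
  -- that of `a`; had it exceeded `w a`, `lt_of_lt_apply` would reverse this.
  have hqa : s' c < w a := by
    have h3 := hcov'.2.2 c hac (by simp only; omega)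
    simp only [hxb'] at h3
    rw [← hsc'] at h3
    have h4 : ¬ w a < s' c := by
      intro h5
      rw [hsc'] at h5
      have := hc1'.1.lt_of_lt_apply hac hck h5
      omega
    have h5 : w a ≠ s' c := by
      rw [hsc']
      rcases hc1'.1.apply_eq_or hck with h | ⟨q, hq, -, h⟩
      · rw [h]
        exact fun e => hac.ne (w.injective e)
      · rw [h]
        intro e
        have e' := w.injective e
        have := hc1'.1.le_snd (List.mem_map_of_mem hq)
        omega
    omega
  have hua2 : w a ≤ u a := by
    refine le_trans ?_ (hr.le_apply hak)
    exact hc1.le_apply hak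
  -- The final value at `β` is at most `s' c < w a`, hence below `u β = w b`. So `m` must exchange
  -- `β` with some `d`, whose value is then at most `s' c`.
  have hβm : β ∈ m.map Prod.snd := by
    by_contra hcon
    have := hm.apply_of_not_mem_snd hkβ hcon
    omega
  obtain ⟨⟨d, β'⟩, hp, rfl⟩ := List.mem_map.1 hβm
  obtain ⟨m₁, m₂, rfl⟩ := List.append_of_mem hp
  obtain ⟨hd, hm₁⟩ := hm.append
  simp only at *
  set x := chainPerm u m₂ with hx
  set z := chainPerm u ((d, β') :: m₂) with hz
  rw [chainPerm_append, ← hz] at hvβ hva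
  have hdk : d < k := hd.2.1
  have hzβ : z β' = x d := chainPerm_cons_apply_snd _ _ _ _
  have hxβ : x β' = w b := hd.apply_snd_of_cons.trans huβ
  have hβ₁ : β' ∉ m₁.map Prod.snd := by
    intro hmem
    have := hm₁.apply_lt_of_mem_snd hmem
    obtain ⟨q, hq, e⟩ := List.mem_map.1 hmem
    obtain ⟨m₃, m₄, rfl⟩ := List.append_of_mem hq
    rw [List.append_assoc, List.cons_append] at hm
    have h7 := hm.append.1.snd_not_mem
    rw [e] at h7
    simp at h7
  rw [hm₁.apply_of_not_mem_snd hkβ hβ₁, hzβ] at hvβ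
  have hxa : x a < w b := by
    have hor : x a = u a ∨ ∃ q ∈ m₂, q.1 = a ∧ x a = u q.2 := hd.1.apply_eq_or hak
    rcases hor with h | ⟨q, hq, -, h⟩
    · omega
    · have : u q.2 < u β' := hd.2.2.2.2 q hq
      omega
  have hxa2 : u a ≤ x a := hd.1.le_apply hak
  have hda : d ≠ a := by
    rintro rfl
    omega
  -- For `d < a`, the value at `a` would lie strictly between the two exchanged values, which is no
  -- cover. For `d > a`, position `d` now holds `w b` and blocks `a` as `c` did.
  have had : a < d := by
    by_contra hcon
    have h8 := hd.2.2.2.1.2.2 a (by simp only; omega) (by simp only; omega)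
    simp only [← hx] at h8
    omega
  have hzd : z d = w b := by rw [hz, chainPerm_cons_apply_fst, ← hx, hxβ]
  have hza : z a = x a := chainPerm_cons_apply_of_ne _ _ (by omega) (by omega)
  obtain ⟨_, h9, h10⟩ := hm₁.exists_jump had hdk (hza ▸ hxa) hzd.ge hva
  omega

/-- A Pieri chain that can be continued to a given permutation by a second one is determined by
the positions `≥ k` that it uses. -/
theorem pieriChain_eq {k : ℕ} {w : Perm ℕ} {l l' m m' : List (ℕ × ℕ)}
    (hl : PieriChain k w l) (hl' : PieriChain k w l') (hs : l.map Prod.snd = l'.map Prod.snd)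
    (hm : PieriChain k (chainPerm w l) m) (hm' : PieriChain k (chainPerm w l') m')
    (hv : chainPerm (chainPerm w l) m = chainPerm (chainPerm w l') m') : l = l' := by
  by_contra hne
  obtain ⟨r, t, t', a, a', b, rfl, rfl, ha⟩ := exists_last_difference hs hne
  rcases lt_or_gt_of_ne ha with h | h
  · exact pieriChain_difference_aux hl' hl h hm' hm hv.symm
  · exact pieriChain_difference_aux hl hl' h hm hm' hv

/-! ### Bruhat operators on the free module of permutations -/

open Classical in
/-- The Bruhat operator exchanging positions `a < b`: a permutation is sent to its cover, or to `0`
if the exchange is not a cover. -/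
noncomputable def bruhatOp (a b : ℕ) : (Perm ℕ →₀ ℤ) →ₗ[ℤ] (Perm ℕ →₀ ℤ) :=
  Finsupp.linearCombination ℤ fun u : Perm ℕ =>
    if BruhatCover u a b then Finsupp.single (u * swap a b) (1 : ℤ) else 0

theorem bruhatOp_of_cover {u : Perm ℕ} {a b : ℕ} (h : BruhatCover u a b) :
    bruhatOp a b (Finsupp.single u 1) = Finsupp.single (u * swap a b) 1 := by
  rw [bruhatOp, Finsupp.linearCombination_single, one_smul, if_pos h]

theorem bruhatOp_of_not_cover {u : Perm ℕ} {a b : ℕ} (h : ¬ BruhatCover u a b) :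
    bruhatOp a b (Finsupp.single u 1) = 0 := by
  rw [bruhatOp, Finsupp.linearCombination_single, one_smul, if_neg h]

theorem bruhatOp_of_lt {u : Perm ℕ} {a b : ℕ} (h : u b < u a) :
    bruhatOp a b (Finsupp.single u 1) = 0 :=
  bruhatOp_of_not_cover fun h' => by have := h'.2.1; omega

theorem linearMap_congr_support {M : Type*} [AddCommGroup M] [Module ℤ M]
    {f g : (Perm ℕ →₀ ℤ) →ₗ[ℤ] M} {m : Perm ℕ →₀ ℤ}
    (h : ∀ u ∈ m.support, f (Finsupp.single u 1) = g (Finsupp.single u 1)) : f m = g m := by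
  have key : ∀ f : (Perm ℕ →₀ ℤ) →ₗ[ℤ] M,
      f m = ∑ u ∈ m.support, m u • f (Finsupp.single u 1) := by
    intro f
    conv_lhs => rw [← m.sum_single, Finsupp.sum, map_sum]
    refine Finset.sum_congr rfl fun u _ => ?_
    have e : Finsupp.single u (m u) = m u • Finsupp.single u (1 : ℤ) := by
      rw [Finsupp.smul_single, smul_eq_mul, mul_one]
    rw [e]
    exact map_zsmul f (m u) _
  rw [key f, key g]
  exact Finset.sum_congr rfl fun u hu => by rw [h u hu]

theorem linearMap_congr {f g : (Perm ℕ →₀ ℤ) →ₗ[ℤ] (Perm ℕ →₀ ℤ)} {m : Perm ℕ →₀ ℤ}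
    (h : ∀ u, f (Finsupp.single u 1) = g (Finsupp.single u 1)) : f m = g m :=
  linearMap_congr_support fun u _ => h u

theorem bruhatOp_comm {a b c d : ℕ} (h1 : a ≠ c) (h2 : a ≠ d) (h3 : b ≠ c) (h4 : b ≠ d)
    (m : Perm ℕ →₀ ℤ) : bruhatOp a b (bruhatOp c d m) = bruhatOp c d (bruhatOp a b m) := by
  refine linearMap_congr (f := bruhatOp a b ∘ₗ bruhatOp c d)
    (g := bruhatOp c d ∘ₗ bruhatOp a b) fun u => ?_
  have hiff : BruhatCover u c d ∧ BruhatCover (u * swap c d) a b ↔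
      BruhatCover u a b ∧ BruhatCover (u * swap a b) c d := by
    simp only [BruhatCover, Perm.mul_apply]
    have e1 := swap_apply_of_ne_of_ne h1 h2
    have e2 := swap_apply_of_ne_of_ne h3 h4
    have e3 := swap_apply_of_ne_of_ne h1.symm h3.symm
    have e4 := swap_apply_of_ne_of_ne h2.symm h4.symm
    rw [e1, e2, e3, e4]
    constructor
    · rintro ⟨⟨p1, p2, p3⟩, q1, q2, q3⟩
      have pa := p3 a
      have pb := p3 b
      have qc := q3 c
      have qd := q3 d
      simp only [swap_apply_left, swap_apply_right] at qc qd
      refine ⟨⟨q1, q2, fun x hx hx' => ?_⟩, p1, p2, fun x hx hx' => ?_⟩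
      · have := q3 x hx hx'
        rw [swap_apply_def] at this
        grind
      · have := p3 x hx hx'
        rw [swap_apply_def]
        grind
    · rintro ⟨⟨p1, p2, p3⟩, q1, q2, q3⟩
      have pa := p3 c
      have pb := p3 d
      have qc := q3 a
      have qd := q3 b
      simp only [swap_apply_left, swap_apply_right] at qc qd
      refine ⟨⟨q1, q2, fun x hx hx' => ?_⟩, p1, p2, fun x hx hx' => ?_⟩
      · have := q3 x hx hx'
        rw [swap_apply_def] at this
        grind
      · have := p3 x hx hx'
        rw [swap_apply_def]
        grind
  simp only [LinearMap.comp_apply]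
  by_cases hc : BruhatCover u c d
  · rw [bruhatOp_of_cover hc]
    by_cases ha : BruhatCover (u * swap c d) a b
    · obtain ⟨h5, h6⟩ := hiff.1 ⟨hc, ha⟩
      rw [bruhatOp_of_cover ha, bruhatOp_of_cover h5, bruhatOp_of_cover h6, mul_assoc, mul_assoc,
        swap_mul_swap_comm h1 h2 h3 h4]
    · rw [bruhatOp_of_not_cover ha]
      by_cases h5 : BruhatCover u a b
      · rw [bruhatOp_of_cover h5, bruhatOp_of_not_cover fun h6 => ha (hiff.2 ⟨h5, h6⟩).2]
      · rw [bruhatOp_of_not_cover h5, map_zero]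
  · rw [bruhatOp_of_not_cover hc, map_zero]
    by_cases h5 : BruhatCover u a b
    · rw [bruhatOp_of_cover h5, bruhatOp_of_not_cover fun h6 => hc (hiff.2 ⟨h5, h6⟩).1]
    · rw [bruhatOp_of_not_cover h5, map_zero]

/-- The quadratic relation between the Bruhat operators on three positions. -/
theorem bruhatOp_relation {a k b : ℕ} (hak : a < k) (hkb : k < b) (m : Perm ℕ →₀ ℤ) :
    bruhatOp a k (bruhatOp k b m)
      = bruhatOp k b (bruhatOp a b m) + bruhatOp a b (bruhatOp a k m) := by
  refine linearMap_congr (f := bruhatOp a k ∘ₗ bruhatOp k b)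
    (g := bruhatOp k b ∘ₗ bruhatOp a b + bruhatOp a b ∘ₗ bruhatOp a k) fun u => ?_
  have hab : a < b := hak.trans hkb
  have hne1 : u a ≠ u k := fun e => by have := u.injective e; omega
  have hne2 : u a ≠ u b := fun e => by have := u.injective e; omega
  have hne3 : u k ≠ u b := fun e => by have := u.injective e; omega
  have kb : ∀ x, swap k b x = if x = k then b else if x = b then k else x := swap_apply_def k b
  have ab : ∀ x, swap a b x = if x = a then b else if x = b then a else x := swap_apply_def a b
  have ak : ∀ x, swap a k x = if x = a then k else if x = k then a else x := swap_apply_def a k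
  have e1 : swap k b * swap a k = swap a b * swap k b := by
    rw [swap_mul_eq_mul_swap (x := a) (y := b), swap_inv, swap_apply_right,
      swap_apply_of_ne_of_ne (by omega) (by omega)]
  have e2 : swap k b * swap a k = swap a k * swap a b := by
    rw [swap_mul_eq_mul_swap (x := k) (y := b), swap_inv, swap_apply_right,
      swap_apply_of_ne_of_ne (by omega) (by omega)]
  have h1 : BruhatCover u k b ∧ BruhatCover (u * swap k b) a k ↔
      (BruhatCover u a b ∧ BruhatCover (u * swap a b) k b) ∨
      (BruhatCover u a k ∧ BruhatCover (u * swap a k) a b) := by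
    simp only [BruhatCover, Perm.mul_apply]
    constructor
    · rintro ⟨⟨-, p2, p3⟩, -, q2, q3⟩
      rw [swap_apply_left, kb a, if_neg (by omega), if_neg (by omega)] at q2 q3
      by_cases hc : u a < u k
      · right
        rw [swap_apply_left, ak b, if_neg (by omega), if_neg (by omega)]
        refine ⟨⟨hak, hc, fun x hx hx' => ?_⟩, hab, p2, fun x hx hx' => ?_⟩
        · have := q3 x hx hx'
          rw [kb x] at this
          grind
        · have := q3 x hx
          have := p3 x
          rw [kb x] at *
          rw [ak x]
          grind
      · left
        rw [swap_apply_right, ab k, if_neg (by omega), if_neg (by omega)]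
        refine ⟨⟨hab, q2, fun x hx hx' => ?_⟩, hkb, by omega, fun x hx hx' => ?_⟩
        · have := q3 x hx
          have := p3 x
          rw [kb x] at *
          grind
        · have := p3 x hx hx'
          have := q3 x
          rw [ab x]
          rw [kb x] at *
          grind
    · rintro (⟨⟨-, p2, p3⟩, -, q2, q3⟩ | ⟨⟨-, p2, p3⟩, -, q2, q3⟩)
      · rw [swap_apply_right, ab k, if_neg (by omega), if_neg (by omega)] at q2 q3
        rw [swap_apply_left, kb a, if_neg (by omega), if_neg (by omega)]
        have := p3 k hak hkb
        refine ⟨⟨hkb, by omega, fun x hx hx' => ?_⟩, hak, p2, fun x hx hx' => ?_⟩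
        · have := q3 x hx hx'
          have := p3 x
          rw [ab x] at *
          grind
        · have := p3 x hx
          rw [kb x]
          grind
      · rw [swap_apply_left, ak b, if_neg (by omega), if_neg (by omega)] at q2 q3
        rw [swap_apply_left, kb a, if_neg (by omega), if_neg (by omega)]
        refine ⟨⟨hkb, q2, fun x hx hx' => ?_⟩, hak, by omega, fun x hx hx' => ?_⟩
        · have := q3 x (by omega) hx'
          rw [ak x] at this
          grind
        · have := p3 x hx hx'
          have := q3 x
          rw [ak x] at *
          rw [kb x]
          grind
  have h2 : ¬ ((BruhatCover u a b ∧ BruhatCover (u * swap a b) k b) ∧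
      (BruhatCover u a k ∧ BruhatCover (u * swap a k) a b)) := by
    rintro ⟨⟨-, -, p2, -⟩, ⟨-, q2, -⟩, -⟩
    rw [Perm.mul_apply, Perm.mul_apply, swap_apply_right, ab k, if_neg (by omega),
      if_neg (by omega)] at p2
    omega
  have comp : ∀ a b c d, bruhatOp c d (bruhatOp a b (Finsupp.single u 1))
      = open Classical in if BruhatCover u a b ∧ BruhatCover (u * swap a b) c d then
        Finsupp.single (u * swap a b * swap c d) 1 else 0 := by
    intro a b c d
    split_ifs with h
    · rw [bruhatOp_of_cover h.1, bruhatOp_of_cover h.2]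
    · by_cases hc : BruhatCover u a b
      · rw [bruhatOp_of_cover hc, bruhatOp_of_not_cover fun h' => h ⟨hc, h'⟩]
      · rw [bruhatOp_of_not_cover hc, map_zero]
  simp only [LinearMap.comp_apply, LinearMap.add_apply, comp, mul_assoc, e1]
  rw [← e2, e1]
  by_cases hA : BruhatCover u a b ∧ BruhatCover (u * swap a b) k b
  · rw [if_pos hA, if_pos (h1.2 (Or.inl hA)), if_neg fun hB => h2 ⟨hA, hB⟩, add_zero]
  · rw [if_neg hA, zero_add]
    by_cases hB : BruhatCover u a k ∧ BruhatCover (u * swap a k) a b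
    · rw [if_pos hB, if_pos (h1.2 (Or.inr hB))]
    · rw [if_neg hB, if_neg fun h => (h1.1 h).elim hA hB]

/-! ### Sums over chains and their recursions in k -/

/-- The sum of the covers of a permutation that exchange a position `< k` with position `b`. -/
noncomputable def coverOp (k b : ℕ) : (Perm ℕ →₀ ℤ) →ₗ[ℤ] (Perm ℕ →₀ ℤ) :=
  ∑ a ∈ Finset.range k, bruhatOp a b

theorem coverOp_apply (k b : ℕ) (m : Perm ℕ →₀ ℤ) :
    coverOp k b m = ∑ a ∈ Finset.range k, bruhatOp a b m := by
  rw [coverOp, LinearMap.sum_apply]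

theorem coverOp_succ (k b : ℕ) (m : Perm ℕ →₀ ℤ) :
    coverOp (k + 1) b m = coverOp k b m + bruhatOp k b m := by
  rw [coverOp_apply, Finset.sum_range_succ, ← coverOp_apply]

/-- The elements of `B`, by decreasing values of `w`. -/
noncomputable def valueSort (w : Perm ℕ) (B : Finset ℕ) : List ℕ :=
  ((B.image w).sort (· ≥ ·)).map (w⁻¹ : Perm ℕ)

theorem mem_valueSort {w : Perm ℕ} {B : Finset ℕ} {b : ℕ} : b ∈ valueSort w B ↔ b ∈ B := by
  simp [valueSort]

theorem valueSort_insert {w : Perm ℕ} {B : Finset ℕ} {b : ℕ} (hb : ∀ x ∈ B, w x < w b) :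
    valueSort w (insert b B) = b :: valueSort w B := by
  have h1 : ∀ y ∈ B.image w, w b ≥ y := by
    intro y hy
    obtain ⟨x, hx, rfl⟩ := Finset.mem_image.1 hy
    exact (hb x hx).le
  have h2 : w b ∉ B.image w := by
    intro h
    obtain ⟨x, hx, e⟩ := Finset.mem_image.1 h
    exact (hb x hx).ne e
  rw [valueSort, Finset.image_insert, Finset.sort_insert (r := (· ≥ ·)) h1 h2]
  simp [valueSort]

/-- The sum of the ends of the Pieri chains from `w` that use the set `B` of positions. -/
noncomputable def chainSum (k : ℕ) (B : Finset ℕ) (w : Perm ℕ) : Perm ℕ →₀ ℤ :=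
  (valueSort w B).foldr (fun b m => coverOp k b m) (Finsupp.single w 1)

theorem chainSum_empty (k : ℕ) (w : Perm ℕ) : chainSum k ∅ w = Finsupp.single w 1 := by
  simp [chainSum, valueSort]

theorem chainSum_insert (k : ℕ) {B : Finset ℕ} {w : Perm ℕ} {b : ℕ} (hb : ∀ x ∈ B, w x < w b) :
    chainSum k (insert b B) w = coverOp k b (chainSum k B w) := by
  rw [chainSum, valueSort_insert hb, List.foldr_cons, chainSum]

/-- Induction on finite sets by adding elements in the order of increasing values of `w`. -/
theorem value_induction (w : Perm ℕ) {P : Finset ℕ → Prop} (empty : P ∅)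
    (insert : ∀ B b, (∀ x ∈ B, w x < w b) → P B → P (insert b B)) (B : Finset ℕ) : P B := by
  refine Finset.induction_on_max_value w B empty fun b B hb h hP => insert B b (fun x hx => ?_) hP
  refine lt_of_le_of_ne (h x hx) fun e => hb ?_
  rwa [← w.injective e]

theorem mem_support_coverOp {k b : ℕ} {m : Perm ℕ →₀ ℤ} {u : Perm ℕ}
    (hu : u ∈ (coverOp k b m).support) :
    ∃ a < k, ∃ v ∈ m.support, BruhatCover v a b ∧ u = v * swap a b := by
  classical
  rw [coverOp_apply] at hu
  obtain ⟨a, ha, hu⟩ := Finset.mem_biUnion.1 (Finsupp.support_finsetSum hu)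
  rw [bruhatOp, Finsupp.linearCombination_apply] at hu
  obtain ⟨v, hv, hu⟩ := Finset.mem_biUnion.1 (Finsupp.support_sum hu)
  split_ifs at hu with hc
  · refine ⟨a, Finset.mem_range.1 ha, v, hv, hc, ?_⟩
    have h1 := Finsupp.support_smul hu
    exact Finset.mem_singleton.1 (Finsupp.support_single_subset h1)
  · simp at hu

theorem exists_pieriChain_of_mem_support {k : ℕ} {w : Perm ℕ} {B : Finset ℕ}
    (hB : ∀ b ∈ B, k ≤ b) {u : Perm ℕ} (hu : u ∈ (chainSum k B w).support) :
    ∃ l, PieriChain k w l ∧ l.map Prod.snd = valueSort w B ∧ chainPerm w l = u := by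
  induction B using value_induction w generalizing u with
  | empty =>
    rw [chainSum_empty] at hu
    have := Finset.mem_singleton.1 (Finsupp.support_single_subset hu)
    exact ⟨[], trivial, by simp [valueSort], this.symm⟩
  | insert B b hb ih =>
    rw [chainSum_insert k hb] at hu
    obtain ⟨a, ha, v, hv, hc, rfl⟩ := mem_support_coverOp hu
    obtain ⟨l, hl, hs, rfl⟩ := ih (fun x hx => hB x (Finset.mem_insert_of_mem hx)) hv
    refine ⟨(a, b) :: l, ⟨hl, ha, hB b (Finset.mem_insert_self b B), hc, fun q hq => ?_⟩, ?_, rfl⟩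
    · refine hb _ ((mem_valueSort (w := w)).1 ?_)
      rw [← hs]
      exact List.mem_map_of_mem hq
    · rw [List.map_cons, hs, valueSort_insert hb]

section support

variable {k : ℕ} {w : Perm ℕ} {B : Finset ℕ} {u : Perm ℕ}

theorem chainSum_apply_eq (hB : ∀ b ∈ B, k ≤ b) (hu : u ∈ (chainSum k B w).support) {x : ℕ}
    (hx : k ≤ x) (hxB : x ∉ B) : u x = w x := by
  obtain ⟨l, hl, hs, rfl⟩ := exists_pieriChain_of_mem_support hB hu
  refine hl.apply_of_not_mem_snd hx ?_
  rwa [hs, mem_valueSort]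

theorem chainSum_apply_lt (hB : ∀ b ∈ B, k ≤ b) (hu : u ∈ (chainSum k B w).support) {x : ℕ}
    (hxB : x ∈ B) : u x < w x := by
  obtain ⟨l, hl, hs, rfl⟩ := exists_pieriChain_of_mem_support hB hu
  refine hl.apply_lt_of_mem_snd ?_
  rwa [hs, mem_valueSort]

theorem chainSum_apply_eq_or (hB : ∀ b ∈ B, k ≤ b) (hu : u ∈ (chainSum k B w).support) {a : ℕ}
    (ha : a < k) : u a = w a ∨ ∃ b ∈ B, u a = w b := by
  obtain ⟨l, hl, hs, rfl⟩ := exists_pieriChain_of_mem_support hB hu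
  rcases hl.apply_eq_or ha with h | ⟨q, hq, -, h⟩
  · exact Or.inl h
  · refine Or.inr ⟨q.2, (mem_valueSort (w := w)).1 ?_, h⟩
    rw [← hs]
    exact List.mem_map_of_mem hq

end support

theorem bruhatOp_bruhatOp_eq_zero_of_support {a b c d : ℕ} {m : Perm ℕ →₀ ℤ}
    (h : ∀ u ∈ m.support, (u * swap c d) b < (u * swap c d) a) :
    bruhatOp a b (bruhatOp c d m) = 0 := by
  refine linearMap_congr_support (f := bruhatOp a b ∘ₗ bruhatOp c d) (g := 0) fun u hu => ?_
  rw [LinearMap.comp_apply, LinearMap.zero_apply]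
  by_cases hc : BruhatCover u c d
  · rw [bruhatOp_of_cover hc, bruhatOp_of_lt (h u hu)]
  · rw [bruhatOp_of_not_cover hc, map_zero]

theorem bruhatOp_eq_zero_of_support {a b : ℕ} {m : Perm ℕ →₀ ℤ}
    (h : ∀ u ∈ m.support, u b < u a) : bruhatOp a b m = 0 :=
  linearMap_congr_support (g := 0) fun u hu => bruhatOp_of_lt (h u hu)

theorem bruhatOp_bruhatOp_self (a b : ℕ) (m : Perm ℕ →₀ ℤ) :
    bruhatOp a b (bruhatOp a b m) = 0 := by
  refine linearMap_congr (f := bruhatOp a b ∘ₗ bruhatOp a b) (g := 0) fun u => ?_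
  rw [LinearMap.comp_apply, LinearMap.zero_apply]
  by_cases hc : BruhatCover u a b
  · rw [bruhatOp_of_cover hc, bruhatOp_of_lt]
    simpa using hc.2.1
  · rw [bruhatOp_of_not_cover hc, map_zero]

theorem coverOp_bruhatOp_comm {k b c : ℕ} (hb : k < b) (hc : k < c) (hbc : b ≠ c)
    (m : Perm ℕ →₀ ℤ) : coverOp k b (bruhatOp k c m) = bruhatOp k c (coverOp k b m) := by
  rw [coverOp_apply, coverOp_apply, map_sum]
  refine Finset.sum_congr rfl fun a ha => ?_
  have := Finset.mem_range.1 ha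
  exact bruhatOp_comm (by omega) (by omega) (by omega) hbc m

/-- Exchanges with four distinct positions commute, so the commutator comes only from terms sharing
the position `a`. -/
theorem coverOp_coverOp_add {k b : ℕ} (hb : k < b) (m : Perm ℕ →₀ ℤ) :
    coverOp k k (coverOp k b m) + ∑ a ∈ Finset.range k, bruhatOp a b (bruhatOp a k m)
      = coverOp k b (coverOp k k m) + ∑ a ∈ Finset.range k, bruhatOp a k (bruhatOp a b m) := by
  have e1 : coverOp k k (coverOp k b m) = ∑ a ∈ Finset.range k, (bruhatOp a k (bruhatOp a b m)
      + ∑ c ∈ (Finset.range k).erase a, bruhatOp a k (bruhatOp c b m)) := by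
    rw [coverOp_apply]
    refine Finset.sum_congr rfl fun a ha => ?_
    rw [coverOp_apply, map_sum, Finset.add_sum_erase _ (fun c => bruhatOp a k (bruhatOp c b m)) ha]
  have e2 : coverOp k b (coverOp k k m) = ∑ a ∈ Finset.range k, (bruhatOp a b (bruhatOp a k m)
      + ∑ c ∈ (Finset.range k).erase a, bruhatOp a k (bruhatOp c b m)) := by
    have : coverOp k b (coverOp k k m)
        = ∑ a ∈ Finset.range k, ∑ c ∈ Finset.range k, bruhatOp c b (bruhatOp a k m) := by
      rw [coverOp_apply k k, map_sum]
      exact Finset.sum_congr rfl fun a _ => coverOp_apply _ _ _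
    rw [this]
    refine Finset.sum_congr rfl fun a ha => ?_
    rw [← Finset.add_sum_erase _ (fun c => bruhatOp c b (bruhatOp a k m)) ha]
    congr 1
    refine Finset.sum_congr rfl fun c hc => ?_
    have h1 := Finset.mem_range.1 ha
    have h2 := Finset.mem_range.1 (Finset.mem_of_mem_erase hc)
    exact bruhatOp_comm (Finset.ne_of_mem_erase hc) (by omega) (by omega) (by omega) m
  rw [e1, e2, Finset.sum_add_distrib, Finset.sum_add_distrib]
  abel

theorem coverOp_bruhatOp {k b : ℕ} (hb : k < b) (m : Perm ℕ →₀ ℤ) :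
    coverOp k k (bruhatOp k b m)
      = bruhatOp k b (coverOp k b m) + ∑ a ∈ Finset.range k, bruhatOp a b (bruhatOp a k m) := by
  rw [coverOp_apply, coverOp_apply, map_sum, ← Finset.sum_add_distrib]
  exact Finset.sum_congr rfl fun a ha => bruhatOp_relation (Finset.mem_range.1 ha) hb m

/-- Position `k` holds a value above all labels, so it can never be raised. -/
theorem chainSum_succ_of_lt {k : ℕ} {w : Perm ℕ} {B : Finset ℕ} (hB : ∀ b ∈ B, k < b)
    (hw : ∀ b ∈ B, w b < w k) : chainSum (k + 1) B w = chainSum k B w := by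
  induction B using value_induction w with
  | empty => rw [chainSum_empty, chainSum_empty]
  | insert B b hb ih =>
    have hB' : ∀ x ∈ B, k < x := fun x hx => hB x (Finset.mem_insert_of_mem hx)
    rw [chainSum_insert _ hb, chainSum_insert _ hb, coverOp_succ,
      ih hB' fun x hx => hw x (Finset.mem_insert_of_mem hx), bruhatOp_eq_zero_of_support, add_zero]
    intro u hu
    have hkb := hB b (Finset.mem_insert_self b B)
    have hB'' : ∀ x ∈ B, k ≤ x := fun x hx => (hB' x hx).le
    rw [chainSum_apply_eq hB'' hu le_rfl fun h => (hB' k h).ne rfl,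
      chainSum_apply_eq hB'' hu hkb.le fun h => (hb b h).ne rfl]
    exact hw b (Finset.mem_insert_self b B)

/-- Evaluates the negative half of Monk's rule for x_k: the sum over `B` will cancel positive terms,
and the chains through `k` will cancel against the Pieri sum for `k`. The largest label is added
last, and `coverOp k k` is moved past its operator by the quadratic relation. -/
theorem coverOp_chainSum_succ {k : ℕ} {w : Perm ℕ} {B : Finset ℕ} (hB : ∀ b ∈ B, k < b) :
    coverOp k k (chainSum (k + 1) B w)
      = chainSum k (insert k B) w + ∑ b ∈ B, bruhatOp k b (chainSum (k + 1) B w) := by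
  induction B using value_induction w with
  | empty =>
    rw [chainSum_insert k (by simp), chainSum_empty, chainSum_empty, Finset.sum_empty, add_zero]
  | insert B b hb ih =>
    have hB' : ∀ x ∈ B, k < x := fun x hx => hB x (Finset.mem_insert_of_mem hx)
    have hkb := hB b (Finset.mem_insert_self b B)
    have hbB : b ∉ B := fun h => (hb b h).ne rfl
    have hkB : k ∉ B := fun h => (hB' k h).ne rfl
    have hne : w k ≠ w b := fun e => hkb.ne (w.injective e)
    rw [chainSum_insert _ hb, Finset.sum_insert hbB]
    specialize ih hB'
    set m := chainSum (k + 1) B w with hm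
    have hub : ∀ u ∈ m.support, u b = w b := fun u hu =>
      chainSum_apply_eq (fun x hx => hB' x hx) hu hkb hbB
    have e1 : ∑ c ∈ B, bruhatOp k c (coverOp (k + 1) b m)
        = coverOp k b (∑ c ∈ B, bruhatOp k c m) + ∑ c ∈ B, bruhatOp k c (bruhatOp k b m) := by
      rw [map_sum, ← Finset.sum_add_distrib]
      refine Finset.sum_congr rfl fun c hc => ?_
      rw [coverOp_succ, map_add, coverOp_bruhatOp_comm hkb (hB' c hc) fun e => hbB (e ▸ hc)]
    have e2 : coverOp k b (chainSum k (insert k B) w)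
        + ∑ a ∈ Finset.range k, bruhatOp a k (bruhatOp a b m)
        = chainSum k (insert k (insert b B)) w + ∑ c ∈ B, bruhatOp k c (bruhatOp k b m) := by
      rcases lt_or_gt_of_ne hne with h | h
      -- Now `w b` exceeds `w k` and all labels of `B`: whichever position receives `w b` cannot be
      -- raised again, so the correction terms vanish.
      · have z1 : ∑ a ∈ Finset.range k, bruhatOp a k (bruhatOp a b m) = 0 := by
          refine Finset.sum_eq_zero fun a ha => bruhatOp_bruhatOp_eq_zero_of_support fun u hu => ?_
          have := Finset.mem_range.1 ha
          rw [Perm.mul_apply, Perm.mul_apply, swap_apply_left,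
            swap_apply_of_ne_of_ne (by omega) (by omega), hub u hu]
          rcases chainSum_apply_eq_or (fun x hx => hB' x hx) hu (Nat.lt_succ_self k) with
            h' | ⟨c, hc, h'⟩
          · rwa [h']
          · rw [h']
            exact hb c hc
        have z2 : ∑ c ∈ B, bruhatOp k c (bruhatOp k b m) = 0 := by
          refine Finset.sum_eq_zero fun c hc => bruhatOp_bruhatOp_eq_zero_of_support fun u hu => ?_
          have := hB' c hc
          rw [Perm.mul_apply, Perm.mul_apply, swap_apply_left,
            swap_apply_of_ne_of_ne (by omega) (fun e : c = b => hbB (e ▸ hc)), hub u hu]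
          exact (chainSum_apply_lt (fun x hx => hB' x hx) hu hc).trans (hb c hc)
        rw [z1, z2, Finset.insert_comm, chainSum_insert k (b := b)]
        intro x hx
        rcases Finset.mem_insert.1 hx with rfl | hx
        · exact h
        · exact hb x hx
      -- Now `w k` exceeds every label, so `k` has to be exchanged last and `coverOp k k` must
      -- commute past `coverOp k b`.
      · have hm' : m = chainSum k B w :=
          chainSum_succ_of_lt hB' fun x hx => (hb x hx).trans h
        have hsupp : ∀ u ∈ m.support, u k = w k := by
          intro u hu
          rw [hm'] at hu
          exact chainSum_apply_eq (fun x hx => (hB' x hx).le) hu le_rfl hkB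
        have z1 : ∑ a ∈ Finset.range k, bruhatOp a b (bruhatOp a k m) = 0 := by
          refine Finset.sum_eq_zero fun a ha => bruhatOp_bruhatOp_eq_zero_of_support fun u hu => ?_
          have := Finset.mem_range.1 ha
          rw [Perm.mul_apply, Perm.mul_apply, swap_apply_left,
            swap_apply_of_ne_of_ne (by omega) (by omega), hub u hu, hsupp u hu]
          exact h
        have z2 : bruhatOp k b m = 0 :=
          bruhatOp_eq_zero_of_support fun u hu => by rw [hub u hu, hsupp u hu]; exact h
        have e3 := coverOp_coverOp_add hkb m
        rw [z1, add_zero] at e3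
        rw [z2, Finset.sum_eq_zero fun c _ => map_zero _, add_zero, chainSum_insert k (b := k),
          chainSum_insert k (b := k), chainSum_insert k hb, ← hm', e3]
        · intro x hx
          rcases Finset.mem_insert.1 hx with rfl | hx
          · exact h
          · exact (hb x hx).trans h
        · exact fun x hx => (hb x hx).trans h
    have e3 := coverOp_coverOp_add hkb m
    have e4 := coverOp_bruhatOp hkb m
    have e5 := congrArg (coverOp k b) ih
    rw [map_add] at e5
    rw [e1, coverOp_succ, map_add, map_add, e4, bruhatOp_bruhatOp_self, add_zero]
    have e6 : coverOp k k (coverOp k b m) + (bruhatOp k b (coverOp k b m)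
        + ∑ a ∈ Finset.range k, bruhatOp a b (bruhatOp a k m))
        = bruhatOp k b (coverOp k b m) + (coverOp k k (coverOp k b m)
        + ∑ a ∈ Finset.range k, bruhatOp a b (bruhatOp a k m)) := by abel
    rw [e6, e3, e5, add_right_comm, e2]
    abel

/-- Chains that raise position `k` are rewritten with its last raise at the very end: that exchange
commutes with the later ones, which do not involve `k`, while raising `k` to a smaller label after a
larger one gives 0. -/
theorem chainSum_succ {k : ℕ} {w : Perm ℕ} {B : Finset ℕ} (hB : ∀ b ∈ B, k < b) :
    chainSum (k + 1) B w
      = chainSum k B w + ∑ b ∈ B, bruhatOp k b (chainSum (k + 1) (B.erase b) w) := by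
  induction B using value_induction w with
  | empty => rw [chainSum_empty, chainSum_empty, Finset.sum_empty, add_zero]
  | insert B b hb ih =>
    have hB' : ∀ x ∈ B, k < x := fun x hx => hB x (Finset.mem_insert_of_mem hx)
    have hkb := hB b (Finset.mem_insert_self b B)
    have hbB : b ∉ B := fun h => (hb b h).ne rfl
    rw [Finset.sum_insert hbB, Finset.erase_insert hbB, chainSum_insert _ hb, coverOp_succ,
      chainSum_insert _ hb]
    have e := congrArg (coverOp k b) (ih hB')
    rw [map_add, map_sum] at e
    rw [e, add_assoc, add_comm (∑ c ∈ B, _)]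
    congr 2
    refine Finset.sum_congr rfl fun c hc => ?_
    have hbc : b ≠ c := fun e => hbB (e ▸ hc)
    have hb' : ∀ x ∈ B.erase c, w x < w b := fun x hx => hb x (Finset.mem_of_mem_erase hx)
    have hBc : ∀ x ∈ B.erase c, k + 1 ≤ x := fun x hx => hB' x (Finset.mem_of_mem_erase hx)
    rw [Finset.erase_insert_of_ne hbc, chainSum_insert _ hb', coverOp_succ, map_add,
      coverOp_bruhatOp_comm hkb (hB' c hc) hbc, bruhatOp_bruhatOp_eq_zero_of_support, add_zero]
    intro u hu
    have := hB' c hc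
    rw [Perm.mul_apply, Perm.mul_apply, swap_apply_left,
      swap_apply_of_ne_of_ne (by omega) hbc.symm,
      chainSum_apply_eq hBc hu hkb fun h => hbB (Finset.mem_of_mem_erase h),
      chainSum_apply_eq hBc hu this (Finset.notMem_erase c B)]
    exact hb c hc

/-! ### Positions beyond n in a chain from S_n -/

namespace PieriChain

variable {k n : ℕ} {w : Perm ℕ} {l : List (ℕ × ℕ)}

/-- If `c` is still untouched when `b` is exchanged, it holds the value `c < b` between the
exchanged positions. The cover condition then puts a value above `c` at the small position; this is
an earlier label coming from a position beyond `c`, and induction applies. -/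
theorem mem_snd_of_lt (h : PieriChain k w l) (hw : w ∈ symN n) (hk : k ≤ n) {b c : ℕ}
    (hb : b ∈ l.map Prod.snd) (hc : n ≤ c) (hcb : c < b) : c ∈ l.map Prod.snd := by
  induction l generalizing b with
  | nil => simp at hb
  | cons p l ih =>
    obtain ⟨a, d⟩ := p
    rw [List.map_cons, List.mem_cons] at hb ⊢
    rcases hb with hb | hb
    · obtain rfl : b = d := hb
      by_contra hcon
      rw [not_or] at hcon
      have hkb : k ≤ b := by omega
      have h1 : chainPerm w l c = c :=
        (h.1.apply_of_not_mem_snd (hk.trans hc) hcon.2).trans (hw c hc)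
      have h2 : chainPerm w l b = b := h.apply_snd_of_cons.trans (hw b (by omega))
      obtain ⟨h3, ha, -, ⟨h4, h5, h6⟩, -⟩ := h
      simp only at *
      have h7 := h6 c (by omega) hcb
      rcases h3.apply_eq_or ha with h8 | ⟨q, hq, -, h8⟩
      · have := lt_of_mem_symN hw (show a < n by omega)
        omega
      · have hqn : n ≤ q.2 := by
          by_contra hlt
          have := lt_of_mem_symN hw (not_le.1 hlt)
          omega
        have := hw q.2 hqn
        exact hcon.2 (ih h3 (List.mem_map_of_mem hq) (by omega))
    · exact Or.inr (ih h.1 hb hcb)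

/-- The used positions ≥ `n` have no gaps, so there can be none at or beyond `n + l.length`. -/
theorem chainPerm_mem_symN (h : PieriChain k w l) (hw : w ∈ symN n) (hk : k ≤ n) :
    chainPerm w l ∈ symN (n + l.length) := by
  intro x hx
  rw [h.apply_of_not_mem_snd (by omega) fun hm => ?_, hw x (by omega)]
  have hsub : Finset.Ico n (x + 1) ⊆ (l.map Prod.snd).toFinset := by
    intro c hc
    rw [Finset.mem_Ico] at hc
    rw [List.mem_toFinset]
    rcases eq_or_lt_of_le (Nat.lt_succ_iff.1 hc.2) with rfl | hlt
    · exact hm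
    · exact h.mem_snd_of_lt hw hk hm hc.1 hlt
  have h1 := Finset.card_le_card hsub
  have h2 := List.toFinset_card_le (l.map Prod.snd)
  rw [Nat.card_Ico] at h1
  rw [List.length_map] at h2
  omega

theorem nodup_snd (h : PieriChain k w l) : (l.map Prod.snd).Nodup := by
  induction l with
  | nil => simp
  | cons p l ih =>
    rw [List.map_cons, List.nodup_cons]
    exact ⟨h.snd_not_mem, ih h.1⟩

/-- In a Pieri chain from an element of `S_n` the positions `≥ n` are determined by the positions
`< n` and by the length. -/
theorem toFinset_snd_eq {l' : List (ℕ × ℕ)} (h : PieriChain k w l) (h' : PieriChain k w l')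
    (hw : w ∈ symN n) (hk : k ≤ n) (hlen : l.length = l'.length)
    (heq : (l.map Prod.snd).toFinset ∩ Finset.Ico k n
      = (l'.map Prod.snd).toFinset ∩ Finset.Ico k n) :
    (l.map Prod.snd).toFinset = (l'.map Prod.snd).toFinset := by
  have aux : ∀ l l' : List (ℕ × ℕ), PieriChain k w l → PieriChain k w l' → l.length = l'.length →
      (l.map Prod.snd).toFinset ∩ Finset.Ico k n = (l'.map Prod.snd).toFinset ∩ Finset.Ico k n →
      (l.map Prod.snd).toFinset ⊆ (l'.map Prod.snd).toFinset := by
    intro l l' h h' hlen heq x hx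
    have hkx := h.le_snd (List.mem_toFinset.1 hx)
    by_cases hxn : x < n
    · exact (Finset.mem_inter.1 (heq ▸ Finset.mem_inter.2 ⟨hx, Finset.mem_Ico.2 ⟨hkx, hxn⟩⟩)).1
    · by_contra hcon
      have hss : (l'.map Prod.snd).toFinset ⊂ (l.map Prod.snd).toFinset := by
        refine (Finset.ssubset_iff_of_subset fun y hy => ?_).2 ⟨x, hx, hcon⟩
        have hky := h'.le_snd (List.mem_toFinset.1 hy)
        by_cases hyn : y < n
        · exact (Finset.mem_inter.1
            (heq.symm ▸ Finset.mem_inter.2 ⟨hy, Finset.mem_Ico.2 ⟨hky, hyn⟩⟩)).1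
        · have hyx : y < x := by
            by_contra hle
            rcases eq_or_lt_of_le (not_lt.1 hle) with e | hlt
            · exact hcon (e ▸ hy)
            · exact hcon (List.mem_toFinset.2 (h'.mem_snd_of_lt hw hk (List.mem_toFinset.1 hy)
                (not_lt.1 hxn) hlt))
          exact List.mem_toFinset.2 (h.mem_snd_of_lt hw hk (List.mem_toFinset.1 hx)
            (not_lt.1 hyn) hyx)
      have := Finset.card_lt_card hss
      rw [List.toFinset_card_of_nodup h.nodup_snd, List.toFinset_card_of_nodup h'.nodup_snd,
        List.length_map, List.length_map] at this
      omega
  exact Finset.Subset.antisymm (aux l l' h h' hlen heq) (aux l' l h' h hlen.symm heq.symm)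

end PieriChain

theorem length_valueSort (w : Perm ℕ) (B : Finset ℕ) : (valueSort w B).length = B.card := by
  rw [valueSort, List.length_map, Finset.length_sort, Finset.card_image_of_injective _ w.injective]

/-! ### Complete homogeneous polynomials and Pieri's rule -/

/-- The complete homogeneous symmetric polynomial of degree `m` in the first `k` variables. -/
noncomputable def completeH : ℕ → ℕ → MvPolynomial ℕ ℤ
  | _, 0 => 1
  | 0, _ + 1 => 0
  | k + 1, m + 1 => completeH k (m + 1) + X k * completeH (k + 1) m
termination_by k m => k + m

theorem completeH_zero_right (k : ℕ) : completeH k 0 = 1 := by rw [completeH]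

theorem completeH_zero_succ (m : ℕ) : completeH 0 (m + 1) = 0 := by rw [completeH]

theorem completeH_succ_succ (k m : ℕ) :
    completeH (k + 1) (m + 1) = completeH k (m + 1) + X k * completeH (k + 1) m := by
  rw [completeH]

/-- The linear map sending a permutation to its Schubert polynomial. -/
noncomputable def schLin : (Perm ℕ →₀ ℤ) →ₗ[ℤ] MvPolynomial ℕ ℤ :=
  Finsupp.linearCombination ℤ sch

theorem schLin_single (u : Perm ℕ) : schLin (Finsupp.single u 1) = sch u := by
  rw [schLin, Finsupp.linearCombination_single, one_smul]

theorem schLin_bruhatOp_single (u : Perm ℕ) (a b : ℕ) :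
    schLin (bruhatOp a b (Finsupp.single u 1)) = coverSch u a b := by
  by_cases h : BruhatCover u a b
  · rw [bruhatOp_of_cover h, schLin_single, coverSch, if_pos h]
  · rw [bruhatOp_of_not_cover h, map_zero, coverSch, if_neg h]

theorem bruhatOp_eq_zero_of_le {a b : ℕ} (h : b ≤ a) (m : Perm ℕ →₀ ℤ) : bruhatOp a b m = 0 :=
  linearMap_congr (g := 0) fun _ => bruhatOp_of_not_cover fun h' => by have := h'.1; omega

theorem X_mul_schLin {k n N : ℕ} (hN : n < N) (hk : k + 1 < N) {m : Perm ℕ →₀ ℤ}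
    (hm : ∀ u ∈ m.support, u ∈ symN n) :
    X k * schLin m
      = schLin (∑ j ∈ Finset.Ico (k + 1) N, bruhatOp k j m) - schLin (coverOp k k m) := by
  have h1 : ∑ j ∈ Finset.Ico (k + 1) N, bruhatOp k j m = ∑ j ∈ Finset.range N, bruhatOp k j m := by
    refine Finset.sum_subset (fun j hj => ?_) fun j _ hj => ?_
    · rw [Finset.mem_Ico] at hj
      exact Finset.mem_range.2 hj.2
    · have := Finset.mem_range.1 ‹_›
      rw [Finset.mem_Ico] at hj
      exact bruhatOp_eq_zero_of_le (by omega) m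
  have h2 : coverOp k k m = ∑ j ∈ Finset.range N, bruhatOp j k m := by
    rw [coverOp_apply]
    refine Finset.sum_subset (Finset.range_mono (by omega)) fun j _ hj => ?_
    rw [Finset.mem_range] at hj
    exact bruhatOp_eq_zero_of_le (by omega) m
  rw [h1, h2, ← map_sub, ← Finset.sum_sub_distrib]
  have := linearMap_congr_support (f := LinearMap.mulLeft ℤ (X k) ∘ₗ schLin)
    (g := schLin ∘ₗ ∑ j ∈ Finset.range N, (bruhatOp k j - bruhatOp j k)) (m := m) fun u hu => ?_
  · simpa only [LinearMap.comp_apply, LinearMap.sum_apply, LinearMap.sub_apply,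
      LinearMap.mulLeft_apply] using this
  · simp only [LinearMap.comp_apply, LinearMap.sum_apply, LinearMap.sub_apply,
      LinearMap.mulLeft_apply, map_sum, map_sub, schLin_bruhatOp_single, schLin_single]
    exact X_mul_sch u ⟨n, hm u hu⟩ k n N (hm u hu) hN hk

theorem sum_powersetCard_succ {M : Type*} [AddCommMonoid M] (S : Finset ℕ) (m : ℕ)
    (f : ℕ → Finset ℕ → M) :
    ∑ B ∈ S.powersetCard (m + 1), ∑ b ∈ B, f b (B.erase b)
      = ∑ B ∈ S.powersetCard m, ∑ b ∈ S \ B, f b B := by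
  rw [Finset.sum_sigma', Finset.sum_sigma']
  refine Finset.sum_bij' (fun x _ => ⟨x.1.erase x.2, x.2⟩) (fun x _ => ⟨insert x.2 x.1, x.2⟩)
    ?_ ?_ ?_ ?_ ?_
  · rintro ⟨B, b⟩ h
    simp only [Finset.mem_sigma, Finset.mem_powersetCard, Finset.mem_sdiff] at h ⊢
    refine ⟨⟨(Finset.erase_subset _ _).trans h.1.1, ?_⟩, h.1.1 h.2, Finset.notMem_erase _ _⟩
    rw [Finset.card_erase_of_mem h.2, h.1.2]
    rfl
  · rintro ⟨B, b⟩ h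
    simp only [Finset.mem_sigma, Finset.mem_powersetCard, Finset.mem_sdiff] at h ⊢
    refine ⟨⟨Finset.insert_subset h.2.1 h.1.1, ?_⟩, Finset.mem_insert_self _ _⟩
    rw [Finset.card_insert_of_notMem h.2.2, h.1.2]
  · rintro ⟨B, b⟩ h
    simp only [Finset.mem_sigma] at h
    simp only [Finset.insert_erase h.2]
  · rintro ⟨B, b⟩ h
    simp only [Finset.mem_sigma, Finset.mem_sdiff] at h
    simp only [Finset.erase_insert h.2.2]
  · rintro ⟨B, b⟩ h
    rfl

theorem chainSum_zero {B : Finset ℕ} (hB : B.Nonempty) (w : Perm ℕ) : chainSum 0 B w = 0 := by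
  induction B using value_induction w with
  | empty => simp at hB
  | insert B b hb ih => rw [chainSum_insert 0 hb, coverOp_apply, Finset.sum_range_zero]

/-- Pieri's rule for the products with complete homogeneous symmetric polynomials. -/
theorem sch_mul_completeH_eq_sum {n : ℕ} {w : Perm ℕ} (hw : w ∈ symN n) (k m N : ℕ) (hk : k ≤ n)
    (hN : n + m ≤ N) : sch w * completeH k m
      = ∑ B ∈ (Finset.Ico k N).powersetCard m, schLin (chainSum k B w) := by
  induction k generalizing m with
  | zero =>
    cases m with
    | zero => simp [completeH_zero_right, chainSum_empty, schLin_single]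
    | succ m =>
      rw [completeH_zero_succ, mul_zero, Finset.sum_eq_zero]
      intro B hB
      rw [chainSum_zero, map_zero]
      rw [← Finset.card_pos, (Finset.mem_powersetCard.1 hB).2]
      omega
  | succ k ihk =>
    induction m with
    | zero => simp [completeH_zero_right, chainSum_empty, schLin_single]
    | succ m ihm =>
      have hins : Finset.Ico k N = insert k (Finset.Ico (k + 1) N) := by
        rw [Finset.insert_Ico_add_one_left_eq_Ico (by omega)]
      have hkS : k ∉ Finset.Ico (k + 1) N := by simp
      have hlt : ∀ {r : ℕ}, ∀ B ∈ (Finset.Ico (k + 1) N).powersetCard r, ∀ b ∈ B, k < b := by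
        intro r B hB b hb
        have := Finset.mem_Ico.1 ((Finset.mem_powersetCard.1 hB).1 hb)
        omega
      have hnk : ∀ {r : ℕ}, ∀ B ∈ (Finset.Ico (k + 1) N).powersetCard r, k ∉ B :=
        fun B hB h => (hlt B hB k h).ne rfl
      rw [completeH_succ_succ, mul_add, mul_left_comm, ihm (by omega), Finset.mul_sum,
        ihk (m + 1) (by omega) hN, hins, Finset.powersetCard_succ_insert hkS, Finset.sum_union,
        Finset.sum_image]
      -- In Monk's rule the positive terms with `j ∈ B` cancel. The remaining negative term runs
      -- over chains using `k`, and it cancels the sets containing `k` in the Pieri sum for `k`;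
      -- `chainSum_succ` accounts for what is left.
      · have e1 : ∀ B ∈ (Finset.Ico (k + 1) N).powersetCard m, X k * schLin (chainSum (k + 1) B w)
            = ∑ j ∈ Finset.Ico (k + 1) N \ B, schLin (bruhatOp k j (chainSum (k + 1) B w))
              - schLin (chainSum k (insert k B) w) := by
          intro B hB
          rw [X_mul_schLin (n := n + m) (N := N) (by omega) (by omega),
            coverOp_chainSum_succ (hlt B hB),
            ← Finset.sum_sdiff (Finset.mem_powersetCard.1 hB).1, map_add, map_add, map_sum]
          · abel
          · intro u hu
            obtain ⟨l, hl, hs, rfl⟩ := exists_pieriChain_of_mem_support (hlt B hB) hu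
            have := hl.chainPerm_mem_symN hw hk
            rwa [← List.length_map Prod.snd, hs, length_valueSort,
              (Finset.mem_powersetCard.1 hB).2] at this
        rw [Finset.sum_congr rfl e1, Finset.sum_sub_distrib,
          ← sum_powersetCard_succ _ _ fun j B => schLin (bruhatOp k j (chainSum (k + 1) B w)),
          add_add_sub_cancel, ← Finset.sum_add_distrib]
        refine Finset.sum_congr rfl fun B hB => ?_
        rw [chainSum_succ (hlt B hB), map_add, map_sum]
      · intro B hB B' hB' e
        have := congrArg (fun s => Finset.erase s k) e
        simpa only [Finset.erase_insert (hnk B hB), Finset.erase_insert (hnk B' hB')] using this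
      · rw [Finset.disjoint_left]
        intro B hB hB'
        obtain ⟨B', -, rfl⟩ := Finset.mem_image.1 hB'
        exact hnk _ hB (Finset.mem_insert_self k B')

theorem chainSum_eq_sum_chains (k : ℕ) (B : Finset ℕ) (w : Perm ℕ) (hB : ∀ b ∈ B, k ≤ b) :
    ∃ S : Finset (List (ℕ × ℕ)), (∀ l ∈ S, PieriChain k w l ∧ l.map Prod.snd = valueSort w B) ∧
      chainSum k B w = ∑ l ∈ S, Finsupp.single (chainPerm w l) 1 := by
  classical
  induction B using value_induction w with
  | empty => exact ⟨{[]}, by simp [PieriChain, valueSort], by simp [chainSum_empty, chainPerm]⟩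
  | insert B b hb ih =>
    obtain ⟨S, hS, e⟩ := ih fun x hx => hB x (Finset.mem_insert_of_mem hx)
    refine ⟨((S ×ˢ Finset.range k).filter fun x => BruhatCover (chainPerm w x.1) x.2 b).image
      fun x => (x.2, b) :: x.1, fun l hl => ?_, ?_⟩
    · obtain ⟨⟨l, a⟩, hx, rfl⟩ := Finset.mem_image.1 hl
      rw [Finset.mem_filter, Finset.mem_product, Finset.mem_range] at hx
      obtain ⟨h1, h2⟩ := hS l hx.1.1
      refine ⟨⟨h1, hx.1.2, hB b (Finset.mem_insert_self b B), hx.2, fun q hq => hb _ ?_⟩, ?_⟩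
      · rw [← mem_valueSort (w := w), ← h2]
        exact List.mem_map_of_mem hq
      · rw [valueSort_insert hb, List.map_cons, h2]
    · rw [chainSum_insert k hb, e, map_sum, Finset.sum_image, Finset.sum_filter,
        Finset.sum_product]
      · refine Finset.sum_congr rfl fun l _ => ?_
        rw [coverOp_apply]
        refine Finset.sum_congr rfl fun a _ => ?_
        split_ifs with h
        · exact bruhatOp_of_cover h
        · exact bruhatOp_of_not_cover h
      · rintro ⟨l, a⟩ - ⟨l', a'⟩ - h
        simp only [List.cons.injEq, Prod.mk.injEq] at h
        simp [h.1.1, h.2]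

/-- Pieri's rule as a sum over chains. -/
theorem sch_mul_completeH {w : Perm ℕ} (hw : w ∈ symInf) (k m : ℕ) :
    ∃ S : Finset (List (ℕ × ℕ)), (∀ l ∈ S, PieriChain k w l ∧ l.length = m ∧
        l.map Prod.snd = valueSort w (l.map Prod.snd).toFinset) ∧
      sch w * completeH k m = ∑ l ∈ S, sch (chainPerm w l) := by
  classical
  obtain ⟨n₀, hn₀⟩ := hw
  have hw : w ∈ symN (n₀ + k) := symN_mono (by omega) hn₀
  set P := (Finset.Ico k (n₀ + k + m)).powersetCard m with hP
  have hk : ∀ B ∈ P, ∀ b ∈ B, k ≤ b := fun B hB b hb =>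
    (Finset.mem_Ico.1 ((Finset.mem_powersetCard.1 hB).1 hb)).1
  have hfin : ∀ B, (valueSort w B).toFinset = B := fun B => by
    ext b
    rw [List.mem_toFinset, mem_valueSort]
  have ex : ∀ B, ∃ S : Finset (List (ℕ × ℕ)), B ∈ P →
      (∀ l ∈ S, PieriChain k w l ∧ l.map Prod.snd = valueSort w B) ∧
      chainSum k B w = ∑ l ∈ S, Finsupp.single (chainPerm w l) 1 := by
    intro B
    by_cases hB : B ∈ P
    · obtain ⟨S, hS⟩ := chainSum_eq_sum_chains k B w (hk B hB)
      exact ⟨S, fun _ => hS⟩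
    · exact ⟨∅, fun h => absurd h hB⟩
  choose S hS using ex
  refine ⟨P.biUnion S, fun l hl => ?_, ?_⟩
  · obtain ⟨B, hB, hl⟩ := Finset.mem_biUnion.1 hl
    obtain ⟨h1, h2⟩ := (hS B hB).1 l hl
    refine ⟨h1, ?_, ?_⟩
    · rw [← List.length_map Prod.snd, h2, length_valueSort, (Finset.mem_powersetCard.1 hB).2]
    · rw [h2, hfin]
  · rw [sch_mul_completeH_eq_sum hw k m (n₀ + k + m) (by omega) le_rfl, Finset.sum_biUnion]
    · refine Finset.sum_congr rfl fun B hB => ?_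
      rw [(hS B hB).2, map_sum]
      exact Finset.sum_congr rfl fun l _ => schLin_single _
    · intro B hB B' hB' hne
      refine Finset.disjoint_left.2 fun l hl hl' => hne ?_
      rw [← hfin B, ← hfin B', ← ((hS B hB).1 l hl).2, ((hS B' hB').1 l hl').2]

/-! ### The Jacobi–Trudi formula for two rows -/

/-- Pairs of rows of lengths `a`, `b` with entries below `i`, `j` that increase weakly along the
rows and strictly down the columns. -/
def rowPairs (a b i j : ℕ) : Set ((ℕ → ℕ) × (ℕ → ℕ)) :=
  {x | (∀ c < a, x.1 c < i) ∧ (∀ c, a ≤ c → x.1 c = 0) ∧ (∀ c d, c ≤ d → d < a → x.1 c ≤ x.1 d) ∧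
    (∀ c < b, x.2 c < j) ∧ (∀ c, b ≤ c → x.2 c = 0) ∧ (∀ c d, c ≤ d → d < b → x.2 c ≤ x.2 d) ∧
    ∀ c < b, x.1 c < x.2 c}

theorem finite_rowPairs (a b i j : ℕ) : (rowPairs a b i j).Finite := by
  let F : (Fin a → Fin i) × (Fin b → Fin j) → (ℕ → ℕ) × (ℕ → ℕ) := fun y =>
    (fun c => if h : c < a then (y.1 ⟨c, h⟩ : ℕ) else 0,
      fun c => if h : c < b then (y.2 ⟨c, h⟩ : ℕ) else 0)
  refine (Set.finite_range F).subset ?_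
  rintro ⟨f, g⟩ ⟨h1, h2, -, h3, h4, -⟩
  refine ⟨(fun c => ⟨f c, h1 c c.2⟩, fun c => ⟨g c, h3 c c.2⟩), ?_⟩
  refine Prod.ext (funext fun c => ?_) (funext fun c => ?_)
  · by_cases h : c < a
    · simp [F, h]
    · simp [F, h]
      exact (h2 c (not_lt.1 h)).symm
  · by_cases h : c < b
    · simp [F, h]
    · simp [F, h]
      exact (h4 c (not_lt.1 h)).symm

/-- The generating function of `rowPairs`. -/
noncomputable def rowPairSum (a b i j : ℕ) : MvPolynomial ℕ ℤ :=
  ∑ x ∈ (finite_rowPairs a b i j).toFinset,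
    (∏ c ∈ Finset.range a, X (x.1 c)) * ∏ c ∈ Finset.range b, X (x.2 c)

theorem rowPairSum_zero_right (a i j j' : ℕ) : rowPairSum a 0 i j = rowPairSum a 0 i j' := by
  rw [rowPairSum, rowPairSum]
  congr 1
  ext x
  simp [rowPairs]

theorem rowPairSum_zero_zero (i j : ℕ) : rowPairSum 0 0 i j = 1 := by
  have : (finite_rowPairs 0 0 i j).toFinset = {(fun _ => 0, fun _ => 0)} := by
    ext ⟨f, g⟩
    simp [rowPairs, funext_iff]
  rw [rowPairSum, this]
  simp

theorem rowPairSum_entries_zero {a : ℕ} (ha : 0 < a) (b j : ℕ) : rowPairSum a b 0 j = 0 := by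
  rw [rowPairSum, Finset.sum_eq_zero]
  intro x hx
  rw [Set.Finite.mem_toFinset] at hx
  exact absurd (hx.1 0 ha) (by omega)

/-- The last entry of the second row is either below `k` or equal to `k` and deleted. It can be put
back because `b < a` provides a first-row entry above it, which is below `k`. -/
theorem rowPairSum_succ_right {a b : ℕ} (hab : b < a) (k : ℕ) :
    rowPairSum a (b + 1) k (k + 1) = rowPairSum a (b + 1) k k + X k * rowPairSum a b k (k + 1) := by
  rw [rowPairSum, ← Finset.sum_filter_add_sum_filter_not _ (fun x => x.2 b < k)]
  congr 1
  · rw [rowPairSum]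
    refine Finset.sum_congr ?_ fun _ _ => rfl
    ext ⟨f, g⟩
    simp only [Finset.mem_filter, Set.Finite.mem_toFinset, rowPairs, Set.mem_ofPred_eq]
    constructor
    · rintro ⟨⟨h1, h2, h3, h4, h5, h6, h7⟩, h8⟩
      exact ⟨h1, h2, h3, fun c hc => (h6 c b (by omega) (by omega)).trans_lt h8, h5, h6, h7⟩
    · rintro ⟨h1, h2, h3, h4, h5, h6, h7⟩
      exact ⟨⟨h1, h2, h3, fun c hc => (h4 c hc).trans (by omega), h5, h6, h7⟩, h4 b (by omega)⟩
  · rw [rowPairSum, Finset.mul_sum]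
    refine Finset.sum_bij' (fun x _ => (x.1, Function.update x.2 b 0))
      (fun x _ => (x.1, Function.update x.2 b k)) ?_ ?_ ?_ ?_ ?_
    · rintro ⟨f, g⟩ hx
      simp only [Finset.mem_filter, Set.Finite.mem_toFinset, rowPairs, Set.mem_ofPred_eq] at hx ⊢
      obtain ⟨⟨h1, h2, h3, h4, h5, h6, h7⟩, h8⟩ := hx
      refine ⟨h1, h2, h3, fun c hc => ?_, fun c hc => ?_, fun c d hc hd => ?_, fun c hc => ?_⟩
      · rw [Function.update_of_ne (by omega)]
        exact h4 c (by omega)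
      · rcases eq_or_ne c b with rfl | hne
        · rw [Function.update_self]
        · rw [Function.update_of_ne hne]
          exact h5 c (by omega)
      · rw [Function.update_of_ne (by omega), Function.update_of_ne (by omega)]
        exact h6 c d hc (by omega)
      · rw [Function.update_of_ne (by omega)]
        exact h7 c (by omega)
    · rintro ⟨f, g⟩ hx
      simp only [Finset.mem_filter, Set.Finite.mem_toFinset, rowPairs, Set.mem_ofPred_eq] at hx ⊢
      obtain ⟨h1, h2, h3, h4, h5, h6, h7⟩ := hx
      refine ⟨⟨h1, h2, h3, fun c hc => ?_, fun c hc => ?_, fun c d hc hd => ?_, fun c hc => ?_⟩, ?_⟩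
      · rcases eq_or_ne c b with rfl | hne
        · rw [Function.update_self]
          omega
        · rw [Function.update_of_ne hne]
          exact h4 c (by omega)
      · rw [Function.update_of_ne (by omega)]
        exact h5 c (by omega)
      · rcases eq_or_ne d b with rfl | hne
        · rw [Function.update_self]
          rcases eq_or_ne c d with rfl | hne
          · rw [Function.update_self]
          · rw [Function.update_of_ne hne]
            have := h4 c (by omega)
            omega
        · rw [Function.update_of_ne hne, Function.update_of_ne (by omega)]
          exact h6 c d hc (by omega)
      · rcases eq_or_ne c b with rfl | hne
        · rw [Function.update_self]
          exact h1 c hab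
        · rw [Function.update_of_ne hne]
          exact h7 c (by omega)
      · rw [Function.update_self]
        omega
    · rintro ⟨f, g⟩ hx
      simp only [Finset.mem_filter, Set.Finite.mem_toFinset, rowPairs, Set.mem_ofPred_eq] at hx
      obtain ⟨⟨h1, h2, h3, h4, h5, h6, h7⟩, h8⟩ := hx
      have := h4 b (by omega)
      rw [Function.update_idem, show k = g b by omega, Function.update_eq_self]
    · rintro ⟨f, g⟩ hx
      simp only [Set.Finite.mem_toFinset, rowPairs, Set.mem_ofPred_eq] at hx
      have := hx.2.2.2.2.1 b le_rfl
      rw [Function.update_idem, ← this, Function.update_eq_self]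
    · rintro ⟨f, g⟩ hx
      simp only [Finset.mem_filter, Set.Finite.mem_toFinset, rowPairs, Set.mem_ofPred_eq] at hx
      obtain ⟨⟨h1, h2, h3, h4, h5, h6, h7⟩, h8⟩ := hx
      have h9 := h4 b (by omega)
      have h10 : g b = k := by omega
      have : ∏ c ∈ Finset.range b, (X (Function.update g b 0 c) : MvPolynomial ℕ ℤ)
          = ∏ c ∈ Finset.range b, X (g c) := Finset.prod_congr rfl fun c hc => by
        rw [Function.update_of_ne (Finset.mem_range.1 hc).ne]
      simp only [this, Finset.prod_range_succ, h10]
      ring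

/-- The same deletion in the first row; since `b ≤ a`, its last entry has nothing below it. -/
theorem rowPairSum_succ_left {a b : ℕ} (hab : b ≤ a) (k : ℕ) :
    rowPairSum (a + 1) b (k + 1) (k + 1)
      = rowPairSum (a + 1) b k (k + 1) + X k * rowPairSum a b (k + 1) (k + 1) := by
  rw [rowPairSum, ← Finset.sum_filter_add_sum_filter_not _ (fun x => x.1 a < k)]
  congr 1
  · rw [rowPairSum]
    refine Finset.sum_congr ?_ fun _ _ => rfl
    ext ⟨f, g⟩
    simp only [Finset.mem_filter, Set.Finite.mem_toFinset, rowPairs, Set.mem_ofPred_eq]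
    constructor
    · rintro ⟨⟨h1, h2, h3, h4⟩, h8⟩
      exact ⟨fun c hc => (h3 c a (by omega) (by omega)).trans_lt h8, h2, h3, h4⟩
    · rintro ⟨h1, h2, h3, h4⟩
      exact ⟨⟨fun c hc => (h1 c hc).trans (by omega), h2, h3, h4⟩, h1 a (by omega)⟩
  · rw [rowPairSum, Finset.mul_sum]
    refine Finset.sum_bij' (fun x _ => (Function.update x.1 a 0, x.2))
      (fun x _ => (Function.update x.1 a k, x.2)) ?_ ?_ ?_ ?_ ?_
    · rintro ⟨f, g⟩ hx
      simp only [Finset.mem_filter, Set.Finite.mem_toFinset, rowPairs, Set.mem_ofPred_eq] at hx ⊢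
      obtain ⟨⟨h1, h2, h3, h4, h5, h6, h7⟩, h8⟩ := hx
      refine ⟨fun c hc => ?_, fun c hc => ?_, fun c d hc hd => ?_, h4, h5, h6, fun c hc => ?_⟩
      · rw [Function.update_of_ne (by omega)]
        exact h1 c (by omega)
      · rcases eq_or_ne c a with rfl | hne
        · rw [Function.update_self]
        · rw [Function.update_of_ne hne]
          exact h2 c (by omega)
      · rw [Function.update_of_ne (by omega), Function.update_of_ne (by omega)]
        exact h3 c d hc (by omega)
      · rw [Function.update_of_ne (by omega)]
        exact h7 c (by omega)
    · rintro ⟨f, g⟩ hx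
      simp only [Finset.mem_filter, Set.Finite.mem_toFinset, rowPairs, Set.mem_ofPred_eq] at hx ⊢
      obtain ⟨h1, h2, h3, h4, h5, h6, h7⟩ := hx
      refine ⟨⟨fun c hc => ?_, fun c hc => ?_, fun c d hc hd => ?_, h4, h5, h6, fun c hc => ?_⟩, ?_⟩
      · rcases eq_or_ne c a with rfl | hne
        · rw [Function.update_self]
          omega
        · rw [Function.update_of_ne hne]
          exact h1 c (by omega)
      · rw [Function.update_of_ne (by omega)]
        exact h2 c (by omega)
      · rcases eq_or_ne d a with rfl | hne
        · rw [Function.update_self]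
          rcases eq_or_ne c d with rfl | hne
          · rw [Function.update_self]
          · rw [Function.update_of_ne hne]
            have := h1 c (by omega)
            omega
        · rw [Function.update_of_ne hne, Function.update_of_ne (by omega)]
          exact h3 c d hc (by omega)
      · rw [Function.update_of_ne (by omega)]
        exact h7 c (by omega)
      · rw [Function.update_self]
        omega
    · rintro ⟨f, g⟩ hx
      simp only [Finset.mem_filter, Set.Finite.mem_toFinset, rowPairs, Set.mem_ofPred_eq] at hx
      obtain ⟨⟨h1, h2, h3, h4, h5, h6, h7⟩, h8⟩ := hx
      have := h1 a (by omega)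
      rw [Function.update_idem, show k = f a by omega, Function.update_eq_self]
    · rintro ⟨f, g⟩ hx
      simp only [Set.Finite.mem_toFinset, rowPairs, Set.mem_ofPred_eq] at hx
      have := hx.2.1 a le_rfl
      rw [Function.update_idem, ← this, Function.update_eq_self]
    · rintro ⟨f, g⟩ hx
      simp only [Finset.mem_filter, Set.Finite.mem_toFinset, rowPairs, Set.mem_ofPred_eq] at hx
      obtain ⟨⟨h1, h2, h3, h4, h5, h6, h7⟩, h8⟩ := hx
      have h9 := h1 a (by omega)
      have h10 : f a = k := by omega
      have : ∏ c ∈ Finset.range a, (X (Function.update f a 0 c) : MvPolynomial ℕ ℤ)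
          = ∏ c ∈ Finset.range a, X (f c) := Finset.prod_congr rfl fun c hc => by
        rw [Function.update_of_ne (Finset.mem_range.1 hc).ne]
      simp only [this, Finset.prod_range_succ, h10]
      ring

/-- Each first-row entry has a strictly larger one below it, so the smaller bound is automatic. -/
theorem rowPairSum_square (b k : ℕ) :
    rowPairSum b b (k + 1) (k + 1) = rowPairSum b b k (k + 1) := by
  rw [rowPairSum, rowPairSum]
  refine Finset.sum_congr ?_ fun _ _ => rfl
  ext ⟨f, g⟩
  simp only [Set.Finite.mem_toFinset, rowPairs, Set.mem_ofPred_eq]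
  constructor
  · rintro ⟨h1, h2, h3, h4, h5, h6, h7⟩
    refine ⟨fun c hc => ?_, h2, h3, h4, h5, h6, h7⟩
    have := h4 c hc
    have := h7 c hc
    omega
  · rintro ⟨h1, h2⟩
    exact ⟨fun c hc => (h1 c hc).trans (by omega), h2⟩

/-- The complete homogeneous polynomial of degree `m - 1`, which is `0` for `m = 0`. -/
noncomputable def completeHPred (k : ℕ) : ℕ → MvPolynomial ℕ ℤ
  | 0 => 0
  | m + 1 => completeH k m

theorem rowPairSum_eq (k : ℕ) : ∀ a b, b ≤ a → rowPairSum a b k k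
    = completeH k a * completeH k b - completeH k (a + 1) * completeHPred k b := by
  induction k with
  | zero =>
    intro a b hab
    cases a with
    | zero =>
      obtain rfl : b = 0 := by omega
      simp [rowPairSum_zero_zero, completeHPred, completeH_zero_right]
    | succ a =>
      rw [rowPairSum_entries_zero (by omega), completeH_zero_succ, completeH_zero_succ]
      ring
  | succ k ih =>
    -- Raising the two bounds one at a time, second row first, passes through a mixed determinant
    -- whose columns use different numbers of variables.
    have hV : ∀ b a, b ≤ a → rowPairSum a b k (k + 1) = completeH k a * completeH (k + 1) b
        - completeH k (a + 1) * completeHPred (k + 1) b := by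
      intro b
      induction b with
      | zero =>
        intro a _
        rw [rowPairSum_zero_right a k (k + 1) k, ih a 0 (by omega)]
        simp only [completeHPred, completeH_zero_right]
      | succ b ihb =>
        intro a hab
        rw [rowPairSum_succ_right hab, ih a (b + 1) hab, ihb a (by omega), completeH_succ_succ]
        cases b with
        | zero =>
          simp only [completeHPred, completeH_zero_right]
          ring
        | succ b =>
          simp only [completeHPred, completeH_succ_succ]
          ring
    intro a b hab
    induction a, hab using Nat.le_induction with
    | base =>
      rw [rowPairSum_square, hV b b le_rfl]
      cases b with
      | zero => simp only [completeHPred, completeH_zero_right, mul_zero]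
      | succ b =>
        rw [completeH_succ_succ k (b + 1)]
        simp only [completeHPred]
        linear_combination (-completeH (k + 1) (b + 1)) * completeH_succ_succ k b
    | succ a hab iha =>
      rw [rowPairSum_succ_left hab, iha, hV b (a + 1) (by omega), completeH_succ_succ k (a + 1)]
      linear_combination (-completeH (k + 1) b) * completeH_succ_succ k a

theorem schur_eq_rowPairSum {μ : YoungDiagram} {a b : ℕ} (hμ : μ.rowLens = [a, b]) (k : ℕ) :
    schur μ k = rowPairSum a b k k := by
  have hlen : μ.colLen 0 = 2 := by
    rw [← YoungDiagram.length_rowLens, hμ]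
    rfl
  have h0 : μ.rowLen 0 = a := by
    have := YoungDiagram.get_rowLens (μ := μ) (i := 0) (h := by simp [hμ])
    simpa [hμ] using this.symm
  have h1 : μ.rowLen 1 = b := by
    have := YoungDiagram.get_rowLens (μ := μ) (i := 1) (h := by simp [hμ])
    simpa [hμ] using this.symm
  have hmem : ∀ i j, (i, j) ∈ μ ↔ (i = 0 ∧ j < a) ∨ (i = 1 ∧ j < b) := by
    intro i j
    rw [YoungDiagram.mem_iff_lt_rowLen]
    rcases i with _ | _ | i
    · simp [h0]
    · simp [h1]
    · have : (i + 1 + 1, 0) ∉ μ := by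
        rw [YoungDiagram.mem_iff_lt_colLen, hlen]
        omega
      rw [YoungDiagram.mem_iff_lt_rowLen] at this
      simp only [Nat.succ_ne_zero, Nat.add_eq_right, false_and, or_self, iff_false]
      omega
  have hcells : μ.cells = (Finset.range a).image (fun c => (0, c)) ∪
      (Finset.range b).image (fun c => (1, c)) := by
    ext ⟨i, j⟩
    rw [YoungDiagram.mem_cells, hmem]
    simp only [Finset.mem_union, Finset.mem_image, Finset.mem_range, Prod.mk.injEq]
    constructor
    · rintro (⟨rfl, h⟩ | ⟨rfl, h⟩)
      · exact Or.inl ⟨j, h, rfl, rfl⟩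
      · exact Or.inr ⟨j, h, rfl, rfl⟩
    · rintro (⟨_, h, rfl, rfl⟩ | ⟨_, h, rfl, rfl⟩)
      · exact Or.inl ⟨rfl, h⟩
      · exact Or.inr ⟨rfl, h⟩
  have hprod : ∀ T : ℕ → ℕ → ℕ, ∏ c ∈ μ.cells, (X (T c.1 c.2) : MvPolynomial ℕ ℤ)
      = (∏ c ∈ Finset.range a, X (T 0 c)) * ∏ c ∈ Finset.range b, X (T 1 c) := by
    intro T
    rw [hcells, Finset.prod_union, Finset.prod_image, Finset.prod_image]
    · exact fun _ _ _ _ h => congrArg Prod.snd h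
    · exact fun _ _ _ _ h => congrArg Prod.snd h
    · rw [Finset.disjoint_left]
      intro x hx hx'
      obtain ⟨c, -, rfl⟩ := Finset.mem_image.1 hx
      obtain ⟨d, -, hd⟩ := Finset.mem_image.1 hx'
      exact one_ne_zero (congrArg Prod.fst hd)
  have hmem0 : ∀ c, c < a → (0, c) ∈ μ := fun c hc => (hmem 0 c).2 (Or.inl ⟨rfl, hc⟩)
  have hmem1 : ∀ c, c < b → (1, c) ∈ μ := fun c hc => (hmem 1 c).2 (Or.inr ⟨rfl, hc⟩)
  have hnot0 : ∀ c, a ≤ c → (0, c) ∉ μ := fun c hc h => by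
    have := (hmem 0 c).1 h
    omega
  have hnot1 : ∀ c, b ≤ c → (1, c) ∉ μ := fun c hc h => by
    have := (hmem 1 c).1 h
    omega
  rw [schur, rowPairSum]
  refine Finset.sum_bij (fun T _ => (T.1 0, T.1 1)) ?_ ?_ ?_ ?_
  · rintro ⟨T, hT⟩ -
    rw [Set.Finite.mem_toFinset]
    refine ⟨fun c hc => hT (0, c) (hmem0 c hc), fun c hc => T.zeros (hnot0 c hc),
      fun c d hc hd => ?_, fun c hc => hT (1, c) (hmem1 c hc),
      fun c hc => T.zeros (hnot1 c hc), fun c d hc hd => ?_,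
      fun c hc => T.col_strict Nat.zero_lt_one (hmem1 c hc)⟩
    · exact T.row_weak_of_le hc (hmem0 d hd)
    · exact T.row_weak_of_le hc (hmem1 d hd)
  · rintro ⟨T, hT⟩ - ⟨T', hT'⟩ - h
    rw [Prod.mk.injEq] at h
    refine Subtype.ext (SemistandardYoungTableau.ext fun i j => ?_)
    by_cases hc : (i, j) ∈ μ
    · rcases (hmem i j).1 hc with ⟨rfl, -⟩ | ⟨rfl, -⟩
      · exact congrFun h.1 j
      · exact congrFun h.2 j
    · rw [T.zeros hc, T'.zeros hc]
  · rintro ⟨f, g⟩ hx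
    rw [Set.Finite.mem_toFinset] at hx
    obtain ⟨h1, h2, h3, h4, h5, h6, h7⟩ := hx
    let T : SemistandardYoungTableau μ :=
      { entry := fun i j => if i = 0 then f j else if i = 1 then g j else 0
        row_weak' := by
          intro i j₁ j₂ hj hc
          rcases (hmem i j₂).1 hc with ⟨rfl, h⟩ | ⟨rfl, h⟩
          · exact h3 j₁ j₂ hj.le h
          · exact h6 j₁ j₂ hj.le h
        col_strict' := by
          intro i₁ i₂ j hi hc
          rcases (hmem i₂ j).1 hc with ⟨rfl, h⟩ | ⟨rfl, h⟩
          · omega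
          · obtain rfl : i₁ = 0 := by omega
            exact h7 j h
        zeros' := by
          intro i j hc
          rcases i with _ | _ | i
          · exact h2 j (not_lt.1 fun h => hc (hmem0 j h))
          · exact h5 j (not_lt.1 fun h => hc (hmem1 j h))
          · rfl }
    refine ⟨⟨T, fun c hc => ?_⟩, Finset.mem_univ _, rfl⟩
    obtain ⟨i, j⟩ := c
    rcases (hmem i j).1 ((YoungDiagram.mem_cells _).1 hc) with ⟨rfl, h⟩ | ⟨rfl, h⟩
    · exact h1 j h
    · exact h4 j h
  · rintro ⟨T, hT⟩ -
    exact hprod fun i j => T i j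

/-! ### Schubert expansions and the count of chain pairs -/

theorem schubertExpansion_apply {f : MvPolynomial ℕ ℤ} {c : symInf →₀ ℤ}
    (hc : IsSchubertExpansion f c) {v : symInf} {L : MvPolynomial ℕ ℤ →+ ℤ}
    (hv : L (sch v) = 1) (hL : ∀ u ∈ symInf, u ≠ v → L (sch u) = 0) : L f = c v := by
  have hterm : ∀ u a, L (C a * schubert u) = a * L (sch u) := fun u a => by
    rw [← sch_coe, ← smul_eq_C_mul, map_zsmul, smul_eq_mul]
  rw [hc, Finsupp.sum, map_sum, Finset.sum_eq_single v]
  · rw [hterm, hv, mul_one]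
  · intro u _ hu
    rw [hterm, hL u u.2 (fun h => hu (Subtype.ext h)), mul_zero]
  · intro hv'
    rw [Finsupp.notMem_support_iff.1 hv', C_0, zero_mul, map_zero]

theorem schubertExpansion_unique {f : MvPolynomial ℕ ℤ} {c c' : symInf →₀ ℤ}
    (hc : IsSchubertExpansion f c) (hc' : IsSchubertExpansion f c') : c = c' := by
  ext v
  obtain ⟨L, hL⟩ := exists_coeff_functional v.2
  have h1 : L (sch v) = 1 := by rw [hL v v.2, if_pos rfl]
  have h2 : ∀ u ∈ symInf, u ≠ v → L (sch u) = 0 := fun u hu hne => by rw [hL u hu, if_neg hne]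
  rw [← schubertExpansion_apply hc h1 h2, schubertExpansion_apply hc' h1 h2]

theorem IsSchubertExpansion.sub {f g : MvPolynomial ℕ ℤ} {c d : symInf →₀ ℤ}
    (hc : IsSchubertExpansion f c) (hd : IsSchubertExpansion g d) :
    IsSchubertExpansion (f - g) (c - d) := by
  rw [IsSchubertExpansion, Finsupp.sum_sub_index, ← hc, ← hd]
  intro v a b
  rw [C_sub, sub_mul]

theorem exists_schubertExpansion_sum {ι : Type*} (S : Finset ι) (p : ι → Perm ℕ)
    (hp : ∀ i ∈ S, p i ∈ symInf) :
    ∃ c : symInf →₀ ℤ, IsSchubertExpansion (∑ i ∈ S, sch (p i)) c ∧ ∀ v, 0 ≤ c v := by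
  classical
  induction S using Finset.induction_on with
  | empty => exact ⟨0, by simp [IsSchubertExpansion], fun v => le_rfl⟩
  | insert i S hi ih =>
    obtain ⟨c, hc, hc0⟩ := ih fun j hj => hp j (Finset.mem_insert_of_mem hj)
    have hpi := hp i (Finset.mem_insert_self i S)
    refine ⟨Finsupp.single ⟨p i, hpi⟩ 1 + c, ?_, fun v => ?_⟩
    · rw [IsSchubertExpansion, Finsupp.sum_add_index', ← hc, Finsupp.sum_single_index,
        Finset.sum_insert hi, C_1, one_mul, ← sch_coe]
      · rw [C_0, zero_mul]
      · intro v
        rw [C_0, zero_mul]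
      · intro v a b
        rw [C_add, add_mul]
    · rw [Finsupp.add_apply, Finsupp.single_apply]
      have := hc0 v
      split_ifs <;> omega

theorem PieriChain.chainPerm_mem_symInf {k : ℕ} {w : Perm ℕ} {l : List (ℕ × ℕ)}
    (hl : PieriChain k w l) (hw : w ∈ symInf) : chainPerm w l ∈ symInf := by
  obtain ⟨n, hn⟩ := hw
  have hn' : w ∈ symN (max n k) := fun i hi => hn i ((le_max_left n k).trans hi)
  exact mem_symInf_of_mem_symN (hl.chainPerm_mem_symN hn' (le_max_right n k))

/-- The product of a Schubert polynomial and two complete homogeneous polynomials, as a sum over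
pairs of consecutive chains. -/
theorem sch_mul_completeH_mul_completeH {w : Perm ℕ} (hw : w ∈ symInf) (k a b : ℕ) :
    ∃ S : Finset (List (ℕ × ℕ) × List (ℕ × ℕ)),
      (∀ x ∈ S, PieriChain k w x.1 ∧ PieriChain k (chainPerm w x.1) x.2 ∧ x.1.length = a ∧
        x.1.map Prod.snd = valueSort w (x.1.map Prod.snd).toFinset ∧
        x.2.map Prod.snd = valueSort (chainPerm w x.1) (x.2.map Prod.snd).toFinset) ∧
      sch w * (completeH k a * completeH k b)
        = ∑ x ∈ S, sch (chainPerm (chainPerm w x.1) x.2) := by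
  classical
  obtain ⟨S, hS, hsum⟩ := sch_mul_completeH hw k a
  have h : ∀ l : List (ℕ × ℕ), ∃ T : Finset (List (ℕ × ℕ)), l ∈ S →
      (∀ m ∈ T, PieriChain k (chainPerm w l) m ∧
        m.map Prod.snd = valueSort (chainPerm w l) (m.map Prod.snd).toFinset) ∧
      sch (chainPerm w l) * completeH k b = ∑ m ∈ T, sch (chainPerm (chainPerm w l) m) := by
    intro l
    by_cases hl : l ∈ S
    · obtain ⟨T, hT, hT'⟩ := sch_mul_completeH ((hS l hl).1.chainPerm_mem_symInf hw) k b
      exact ⟨T, fun _ => ⟨fun m hm => ⟨(hT m hm).1, (hT m hm).2.2⟩, hT'⟩⟩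
    · exact ⟨∅, fun h => absurd h hl⟩
  choose T hT using h
  refine ⟨(S.sigma T).map (Equiv.sigmaEquivProd _ _).toEmbedding, ?_, ?_⟩
  · intro x hx
    obtain ⟨y, hy, rfl⟩ := Finset.mem_map.1 hx
    obtain ⟨h1, h2⟩ := Finset.mem_sigma.1 hy
    obtain ⟨h3, h4, h5⟩ := hS _ h1
    obtain ⟨h6, h7⟩ := (hT _ h1).1 _ h2
    exact ⟨h3, h6, h4, h5, h7⟩
  · rw [Finset.sum_map, Finset.sum_sigma, ← mul_assoc, hsum, Finset.sum_mul]
    exact Finset.sum_congr rfl fun l hl => (hT l hl).2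

/-- The used positions are exactly those ≥ `k` whose value has dropped, which the two ends reveal.
-/
theorem PieriChain.toFinset_snd {k : ℕ} {u : Perm ℕ} {l l' : List (ℕ × ℕ)}
    (hl : PieriChain k u l) (hl' : PieriChain k u l') (h : chainPerm u l = chainPerm u l') :
    (l.map Prod.snd).toFinset = (l'.map Prod.snd).toFinset := by
  have key : ∀ {m m' : List (ℕ × ℕ)}, PieriChain k u m → PieriChain k u m' →
      chainPerm u m = chainPerm u m' → ∀ x ∈ m.map Prod.snd, x ∈ m'.map Prod.snd := by
    intro m m' hm hm' h x hx
    by_contra hx'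
    have h1 := hm.apply_lt_of_mem_snd hx
    rw [h, hm'.apply_of_not_mem_snd (hm.le_snd hx) hx'] at h1
    exact lt_irrefl _ h1
  ext x
  rw [List.mem_toFinset, List.mem_toFinset]
  exact ⟨key hl hl' h x, key hl' hl h.symm x⟩

/-- Two consecutive chains from `w ∈ S_n` with given lengths and given end are determined by the
positions in `{k, …, n - 1}` that the first of them uses. -/
theorem card_chainPairs_le {n k a : ℕ} (hk : k ≤ n) {w v : Perm ℕ} (hw : w ∈ symN n)
    (S : Finset (List (ℕ × ℕ) × List (ℕ × ℕ)))
    (hS : ∀ x ∈ S, PieriChain k w x.1 ∧ PieriChain k (chainPerm w x.1) x.2 ∧ x.1.length = a ∧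
        x.1.map Prod.snd = valueSort w (x.1.map Prod.snd).toFinset ∧
        x.2.map Prod.snd = valueSort (chainPerm w x.1) (x.2.map Prod.snd).toFinset)
    (hv : ∀ x ∈ S, chainPerm (chainPerm w x.1) x.2 = v) : S.card ≤ 2 ^ (n - k) := by
  rw [← Nat.card_Ico, ← Finset.card_powerset]
  refine Finset.card_le_card_of_injOn
    (fun x => (x.1.map Prod.snd).toFinset ∩ Finset.Ico k n) (fun x _ => ?_) ?_
  · exact Finset.mem_coe.2 (Finset.mem_powerset.2 Finset.inter_subset_right)
  · rintro ⟨l, m⟩ hx ⟨l', m'⟩ hx' h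
    have hvx := hv _ hx
    have hvx' := hv _ hx'
    obtain ⟨h1, h2, h3, h4, h5⟩ := hS _ hx
    obtain ⟨h1', h2', h3', h4', h5'⟩ := hS _ hx'
    dsimp only at *
    have hset := h1.toFinset_snd_eq h1' hw hk (h3.trans h3'.symm) h
    obtain rfl : l = l' := pieriChain_eq h1 h1' (by rw [h4, h4', hset]) h2 h2'
      (hvx.trans hvx'.symm)
    have hset' := h2.toFinset_snd h2' (hvx.trans hvx'.symm)
    -- With the common end reached already, the uniqueness statement is used with empty
    -- continuations.
    obtain rfl : m = m' := pieriChain_eq (m := []) (m' := []) h2 h2' (by rw [h5, h5', hset'])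
      trivial trivial (hvx.trans hvx'.symm)
    rfl

theorem theorem2 (n₁ n₂ k m₁ m₂ : ℕ) (hn₁ : 0 < n₁) (hn₂ : 0 < n₂) (hk : k ≤ n₂)
    (τ : Equiv.Perm ℕ) (hτ : τ ∈ symN n₁) (hG : IsGrassmannian k n₁ τ)
    (μ : YoungDiagram) (hμ : IsShapeOf μ k τ) (hrows : μ.rowLens = [m₁, m₂])
    (w : symInf) (hw : (w : Equiv.Perm ℕ) ∈ symN n₂) (hm : n₂ - k < m₂) :
    (∃! c : symInf →₀ ℤ, IsSchubertExpansion (schubert w * schur μ k) c) ∧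
    ∀ c : symInf →₀ ℤ, IsSchubertExpansion (schubert w * schur μ k) c →
      (∀ v : symInf, c v ≤ 2 ^ (n₂ - k) * (n₂ - k)!) ∧
      ((∀ i, k ≤ i → i + 1 < n₂ →
          (w : Equiv.Perm ℕ) (i + 1) < (w : Equiv.Perm ℕ) i) →
        ∀ v : symInf, c v ≤ 2 ^ (n₂ - k)) := by
  classical
  have hle : m₂ ≤ m₁ := by
    have := μ.rowLens_sorted.pairwise
    rw [hrows] at this
    simpa using this
  -- Makes `completeHPred k m₂` the genuine polynomial `completeH k b`.
  obtain ⟨b, rfl⟩ : ∃ b, m₂ = b + 1 := ⟨m₂ - 1, by omega⟩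
  obtain ⟨S, hS, hSsum⟩ := sch_mul_completeH_mul_completeH w.2 k m₁ (b + 1)
  obtain ⟨T, hT, hTsum⟩ := sch_mul_completeH_mul_completeH w.2 k (m₁ + 1) b
  have hprod : schubert w * schur μ k
      = ∑ x ∈ S, sch (chainPerm (chainPerm w x.1) x.2)
        - ∑ x ∈ T, sch (chainPerm (chainPerm w x.1) x.2) := by
    rw [schur_eq_rowPairSum hrows, rowPairSum_eq k _ _ hle, ← sch_coe, mul_sub, hSsum,
      completeHPred, hTsum]
  have hSmem : ∀ x ∈ S, chainPerm (chainPerm w x.1) x.2 ∈ symInf := fun x hx =>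
    (hS x hx).2.1.chainPerm_mem_symInf ((hS x hx).1.chainPerm_mem_symInf w.2)
  have hTmem : ∀ x ∈ T, chainPerm (chainPerm w x.1) x.2 ∈ symInf := fun x hx =>
    (hT x hx).2.1.chainPerm_mem_symInf ((hT x hx).1.chainPerm_mem_symInf w.2)
  obtain ⟨cS, hcS, -⟩ := exists_schubertExpansion_sum S _ hSmem
  obtain ⟨cT, hcT, hcT0⟩ := exists_schubertExpansion_sum T _ hTmem
  have hexp : IsSchubertExpansion (schubert w * schur μ k) (cS - cT) := by
    rw [hprod]
    exact hcS.sub hcT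
  have hbound : ∀ c : symInf →₀ ℤ, IsSchubertExpansion (schubert w * schur μ k) c →
      ∀ v : symInf, c v ≤ 2 ^ (n₂ - k) := by
    intro c hc v
    rw [schubertExpansion_unique hc hexp, Finsupp.sub_apply]
    -- The dual functional of `v` turns this coefficient into the number of chain pairs ending at
    -- `v`.
    have hcSv : cS v ≤ 2 ^ (n₂ - k) := by
      obtain ⟨L, hL⟩ := exists_coeff_functional v.2
      have h1 : L (sch v) = 1 := by rw [hL v v.2, if_pos rfl]
      have h2 : ∀ u ∈ symInf, u ≠ v → L (sch u) = 0 := fun u hu hne => by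
        rw [hL u hu, if_neg hne]
      have h3 : cS v = ((S.filter fun x =>
          chainPerm (chainPerm w x.1) x.2 = (v : Perm ℕ)).card : ℤ) := by
        rw [← schubertExpansion_apply hcS h1 h2, map_sum, Finset.card_filter, Nat.cast_sum]
        refine Finset.sum_congr rfl fun x hx => ?_
        by_cases h : chainPerm (chainPerm w x.1) x.2 = (v : Perm ℕ)
        · rw [if_pos h, h, h1, Nat.cast_one]
        · rw [if_neg h, h2 _ (hSmem x hx) h, Nat.cast_zero]
      have h4 := card_chainPairs_le (v := v) hk hw
        (S.filter fun x => chainPerm (chainPerm w x.1) x.2 = (v : Perm ℕ))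
        (fun x hx => hS x (Finset.mem_filter.1 hx).1) fun x hx => (Finset.mem_filter.1 hx).2
      rw [h3]
      exact_mod_cast h4
    -- The subtracted product has nonnegative coefficients, so dropping it only enlarges the bound.
    have := hcT0 v
    omega
  refine ⟨⟨cS - cT, hexp, fun c hc => schubertExpansion_unique hc hexp⟩, fun c hc =>
    ⟨fun v => (hbound c hc v).trans ?_, fun _ => hbound c hc⟩⟩
  have h : (1 : ℤ) ≤ ((n₂ - k)! : ℤ) := by exact_mod_cast Nat.factorial_pos (n₂ - k)
  exact le_mul_of_one_le_right (by positivity) h
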